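/- Fix $\rho\in(0,1)$ and let $Q$ be a probability measure on $(0,\infty)$. For $d\in\mathbb{N}$ let $P_d=P_d(Q)$ be the law on $\mathbb{R}^d$ of a random vector $X$ such that $Z\sim Q$ and $X\mid Z\sim N_d(0,Z I_d)$, and let $p_d$ be its Lebesgue density. Let $\mathrm{pCN}(P_d)$ be the law of the Markov chain $(X^d_m)_{m\ge 0}$ in $\mathbb{R}^d$ with $X^d_0\sim P_d$ and, for $m\ge 1$, $X^{d*}_m=\sqrt{\rho}\,X^d_{m-1}+\sqrt{1-\rho}\,W^d_m$, where $W^d_m\sim N_d(0,I_d)$ is independent of the past; one sets $X^d_m=X^{d*}_m$ with probability $\alpha_d(X^d_{m-1},X^{d*}_m)$ and $X^d_m=X^d_{m-1}$ otherwise, where $$\alpha_d(x,y)=\min\left\{1,\frac{p_d(y)\,\phi_d(x)}{p_d(x)\,\phi_d(y)}\right\},\qquad \phi_d(x)=(2\pi)^{-d/2}e^{-\|x\|^2/2}.$$ For a sequence of positive integers $M_d\to\infty$, consider the property $$(\ast)\qquad \frac1{M_d}\sum_{m=0}^{M_d-1} f(\pi_{E_d}(X^d_m))-\int f(\pi_{E_d}(x))\,P_d(\mathrm{d}x)\to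 0\quad\text{in probability as } d\to\infty$$ for every $k\in\mathbb{N}$, every bounded continuous $f:\mathbb{R}^k\to\mathbb{R}$ and every choice of $k$-element sets $E_d\subset\{1,\dots,d\}$ ($d\ge k$), where $\pi_{E}(x)=(x_i)_{i\in E}$. The law $\mathrm{pCN}(P_d)$ is called consistent if $(\ast)$ holds for every $M_d\to\infty$; it is called weakly consistent with rate $T_d>0$ if $(\ast)$ holds for every $M_d\to\infty$ with $M_d/T_d\to\infty$; and it has a polynomial rate of convergence if it is weakly consistent with some rate $T_d>0$ such that $T_d/d^{p}\to 0$ for some $p\in\mathbb{N}$. Then $\mathrm{pCN}(P_d)$ has a polynomial rate of convergence if and only if $Q=\delta_{1}$, that is, if and only if $P_d=N_d(0,I_d)$ for all $d$. Moreover, if $Q=\delta_{1}$, then $\mathrm{pCN}(P_d)$ is consistent; in particular it is weakly consistent with rate $T_d=1$. -/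

import Mathlib

open MeasureTheory ProbabilityTheory Filter Topology
open scoped ENNReal BoundedContinuousFunction

namespace PCN

/-- The state space `ℝ^d` with its Euclidean norm. -/
abbrev E (d : ℕ) : Type := EuclideanSpace ℝ (Fin d)

/-- The density `φ_d(x; 0, I_d)` of the `d`-dimensional standard normal distribution. -/
noncomputable def stdNormalDensity (d : ℕ) (x : E d) : ℝ≥0∞ :=
  ENNReal.ofReal ((2 * Real.pi) ^ (-(d : ℝ) / 2) * Real.exp (-‖x‖ ^ 2 / 2))

/-- The scale mixture of normals `P_d(Q)`: the law of `√Z W` with `Z ∼ Q` and `W ∼ N_d(0, I_d)`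
independent, that is, the law of `X` where `X | Z ∼ N_d(0, Z I_d)` and `Z ∼ Q`. -/
noncomputable def scaleMixture (Q : Measure ℝ) (d : ℕ) : Measure (E d) :=
  (Q.prod (stdGaussian (E d))).map (fun zw : ℝ × E d => Real.sqrt zw.1 • zw.2)

/-- The acceptance probability
`α_d(x, y) = min {1, p(y) φ_d(x; 0, I_d) / (p(x) φ_d(y; 0, I_d))}`
where `p` is the Lebesgue density of the target `P`. -/
noncomputable def accept {d : ℕ} (P : Measure (E d)) (x y : E d) : ℝ≥0∞ :=
  min 1 ((P.rnDeriv volume y * stdNormalDensity d x) /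
    (P.rnDeriv volume x * stdNormalDensity d y))

/-- The proposal `√ρ x + √(1 - ρ) w`. -/
noncomputable def proposal {d : ℕ} (ρ : ℝ) (x w : E d) : E d :=
  Real.sqrt ρ • x + Real.sqrt (1 - ρ) • w

/-- One step of the algorithm from `x`, driven by a Gaussian vector `w` and an independent uniform
variable `u` on `[0, 1]`: the proposal is accepted if `u ≤ α_d(x, x*)` (so with probability
`α_d(x, x*)`), and otherwise the chain stays at `x`. -/
noncomputable def step {d : ℕ} (ρ : ℝ) (P : Measure (E d)) (x : E d) (wu : E d × unitInterval) :
    E d :=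
  if ENNReal.ofReal (wu.2 : ℝ) ≤ accept P x (proposal ρ x wu.1) then proposal ρ x wu.1 else x

/-- The chain with initial value `x₀` and driving sequence `ω`; the `m`-th entry of `ω` drives the
step from time `m` to time `m + 1`. -/
noncomputable def chain {d : ℕ} (ρ : ℝ) (P : Measure (E d)) (x₀ : E d)
    (ω : ℕ → E d × unitInterval) : ℕ → E d
  | 0 => x₀
  | m + 1 => step ρ P (chain ρ P x₀ ω m) (ω m)

/-- The law `pCN(P)` on path space of the chain started from `X_0 ∼ P`, driven by an i.i.d. sequence
of pairs of independent `N_d(0, I_d)` and uniform variables, independent of `X_0`. -/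
noncomputable def pCN {d : ℕ} (ρ : ℝ) (P : Measure (E d)) : Measure (ℕ → E d) :=
  (P.prod (Measure.infinitePi
    (fun _ : ℕ => (stdGaussian (E d)).prod (volume : Measure unitInterval)))).map
      (fun p : E d × (ℕ → E d × unitInterval) => chain ρ P p.1 p.2)

/-! The push-forwards above are along measurable maps, so they are genuine laws. -/

lemma measurable_stdNormalDensity (d : ℕ) : Measurable (stdNormalDensity d) := by
  unfold stdNormalDensity
  fun_prop

lemma measurable_accept {d : ℕ} (P : Measure (E d)) :
    Measurable (fun p : E d × E d => accept P p.1 p.2) := by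
  have h1 := Measure.measurable_rnDeriv P (volume : Measure (E d))
  have h2 := measurable_stdNormalDensity d
  unfold accept
  fun_prop

lemma measurable_step {d : ℕ} (ρ : ℝ) (P : Measure (E d)) :
    Measurable (fun p : E d × (E d × unitInterval) => step ρ P p.1 p.2) := by
  have hp : Measurable (fun p : E d × (E d × unitInterval) => proposal ρ p.1 p.2.1) := by
    unfold proposal
    fun_prop
  have ha : Measurable (fun p : E d × (E d × unitInterval) =>
      accept P p.1 (proposal ρ p.1 p.2.1)) :=
    (measurable_accept P).comp (measurable_fst.prodMk hp)
  have hu : Measurable (fun p : E d × (E d × unitInterval) =>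
      ENNReal.ofReal (p.2.2 : ℝ)) :=
    ENNReal.measurable_ofReal.comp
      (measurable_subtype_coe.comp (measurable_snd.comp measurable_snd))
  exact Measurable.ite (measurableSet_le hu ha) hp measurable_fst

lemma measurable_chain_apply {d : ℕ} (ρ : ℝ) (P : Measure (E d)) (m : ℕ) :
    Measurable (fun p : E d × (ℕ → E d × unitInterval) => chain ρ P p.1 p.2 m) := by
  induction m with
  | zero => exact measurable_fst
  | succ m ih =>
    have hm : Measurable (fun p : E d × (ℕ → E d × unitInterval) => p.2 m) :=
      (measurable_pi_apply m).comp measurable_snd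
    have h : Measurable (fun p : E d × (ℕ → E d × unitInterval) =>
        (chain ρ P p.1 p.2 m, p.2 m)) := ih.prodMk hm
    have h2 := (measurable_step ρ P).comp h
    simpa only [chain, Function.comp_def] using h2

lemma measurable_chain {d : ℕ} (ρ : ℝ) (P : Measure (E d)) :
    Measurable (fun p : E d × (ℕ → E d × unitInterval) => chain ρ P p.1 p.2) :=
  measurable_pi_lambda _ (measurable_chain_apply ρ P)

instance isProbabilityMeasure_scaleMixture (Q : Measure ℝ) [IsProbabilityMeasure Q] (d : ℕ) :
    IsProbabilityMeasure (scaleMixture Q d) :=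
  Measure.isProbabilityMeasure_map (by fun_prop)

instance isProbabilityMeasure_pCN {d : ℕ} (ρ : ℝ) (P : Measure (E d)) [IsProbabilityMeasure P] :
    IsProbabilityMeasure (pCN ρ P) :=
  Measure.isProbabilityMeasure_map (measurable_chain ρ P).aemeasurable

/-- The projection `π_S(x) = (x_i)_{i ∈ S}` onto the coordinates in a `k`-element set `S`, listed
in increasing order (and `0`, a value that is never used, if `S` does not have `k` elements). -/
noncomputable def proj {d : ℕ} (k : ℕ) (S : Finset (Fin d)) (x : E d) : E k :=
  if h : S.card = k then WithLp.toLp 2 (fun j => x (S.orderEmbOfFin h j)) else 0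

/-- For chains with laws `μ d` on path space and target distributions `P d`, the time average over
`M d` steps minus the target mean is `o_ℙ(1)` as `d → ∞`, for every bounded continuous function of
any fixed number `k` of coordinates; the `k` coordinates used may depend on `d`. -/
def AveragesConverge (μ : ∀ d : ℕ, Measure (ℕ → E d)) (P : ∀ d : ℕ, Measure (E d))
    (M : ℕ → ℕ) : Prop :=
  ∀ (k : ℕ) (f : E k →ᵇ ℝ) (S : ∀ d : ℕ, Finset (Fin d)), (∀ d, k ≤ d → (S d).card = k) →
    ∀ ε : ℝ, 0 < ε →
      Tendsto (fun d : ℕ => μ d {x : ℕ → E d |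
        ε ≤ |(1 / (M d : ℝ)) * ∑ m ∈ Finset.range (M d), f (proj k (S d) (x m))
              - ∫ y, f (proj k (S d) y) ∂(P d)|}) atTop (𝓝 0)

/-- Consistency. -/
def Consistent (μ : ∀ d : ℕ, Measure (ℕ → E d)) (P : ∀ d : ℕ, Measure (E d)) : Prop :=
  ∀ M : ℕ → ℕ, Tendsto M atTop atTop → AveragesConverge μ P M

/-- Weak consistency with rate `T_d`, a sequence of positive numbers. -/
def WeaklyConsistent (μ : ∀ d : ℕ, Measure (ℕ → E d)) (P : ∀ d : ℕ, Measure (E d))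
    (T : ℕ → ℝ) : Prop :=
  (∀ᶠ d in atTop, 0 < T d) ∧
    ∀ M : ℕ → ℕ, Tendsto M atTop atTop → Tendsto (fun d => (M d : ℝ) / T d) atTop atTop →
      AveragesConverge μ P M

/-- Polynomial rate of convergence: weak consistency with some rate `T_d = o(d^p)`. -/
def HasPolynomialRate (μ : ∀ d : ℕ, Measure (ℕ → E d)) (P : ∀ d : ℕ, Measure (E d)) : Prop :=
  ∃ T : ℕ → ℝ, WeaklyConsistent μ P T ∧
    ∃ p : ℕ, Tendsto (fun d : ℕ => T d / (d : ℝ) ^ p) atTop (𝓝 0)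

end PCN

/-!
The chain `pCN ρ P` proposes from the Gaussian autoregression `y = √ρ x + √(1 - ρ) w`, which is
reversible for `N_d(0, I_d)` and drives the normalised squared norm `r(x) = ‖x‖² / d` towards `1`.

*A target other than the Gaussian gives no polynomial rate.* In high dimension the proposal moves
`r(x)` to `ρ r(x) + (1 - ρ)`, up to a relative error `δ`, except with probability exponentially small
in `d`, uniformly in `x` (`exists_pow_bound_offDrift`: Chernoff bounds for `‖w‖²` and for `⟪x, w⟫`).
If both `(x, y)` and `(y, x)` follow this drift, then `r(x)` is close to `1`
(`abs_norm_sq_sub_lt_of_not_offDrift`). So from a shell `η ≤ |r(x) - 1|` every move is rare either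
forwards or backwards, and detailed balance turns a move that is rare backwards into one that is
rarely accepted (`setLIntegral_accept_le`). Hence the probability of starting in such a shell and
accepting the first proposal is at most `8 c ^ d` with `c < 1`, and no asymptotics of
the densities of `P_d` are needed. If `Q ≠ δ₁`, then `P_d` charges such a shell with mass bounded below, and on it the chain does not
move for any fixed power of `d` steps (`measure_le_pCN_stuck_add`). The time average of `arctan x₁`
is then the random value `arctan (X₀)₁`, far from its mean `0` (`not_averagesConverge_pow`).

*The Gaussian target is consistent.* For `Q = δ₁` almost surely each proposal is accepted
(`chain_eq_autoreg_ae`), so the chain is the stationary autoregression. One step together with the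
shift of the noise preserves the joint law of initial value and noise
(`measurePreserving_skewShift`), and any `k` coordinates form the `k`-dimensional autoregression.
The covariance at lag `m` of a bounded continuous function of them thus does not depend on `d`, and
it tends to `0` because the `m`-step law is that of `√ρ ^ m x + √(1 - ρ ^ m) w` (`map_autoreg`,
`tendsto_autocov`). Chebyshev's inequality and a Cesàro mean finish the proof.
-/

namespace PCN

/-! ### The standard Gaussian law and the proposal -/

lemma measurable_proposal {d : ℕ} (ρ : ℝ) :
    Measurable (fun p : E d × E d => proposal ρ p.1 p.2) := by
  unfold proposal
  fun_prop

lemma stdGaussian_eq_withDensity (d : ℕ) :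
    stdGaussian (E d) = volume.withDensity (stdNormalDensity d) := by
  have hint : Integrable (fun x : E d => Real.exp (-‖x‖ ^ 2 / 2)) := by
    have h := (GaussianFourier.integrable_cexp_neg_mul_sq_norm_add (V := E d) (b := (1 / 2 : ℂ))
      (by norm_num) 0 0).norm
    refine h.congr (ae_of_all _ fun x => ?_)
    simp only [Complex.norm_exp]
    congr 1
    have : (-(1 / 2 : ℂ) * (‖x‖ : ℂ) ^ 2 + 0 * ((inner ℝ (0 : E d) x : ℝ) : ℂ)) =
        ((-‖x‖ ^ 2 / 2 : ℝ) : ℂ) := by push_cast; ring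
    rw [this, Complex.ofReal_re]
  have : IsFiniteMeasure (volume.withDensity (stdNormalDensity d)) :=
    isFiniteMeasure_withDensity_ofReal (hint.const_mul _).hasFiniteIntegral
  refine Measure.ext_of_charFun ?_
  ext t
  have hpos : (0 : ℝ) < 2 * Real.pi := by positivity
  rw [charFun_stdGaussian, charFun_apply,
    integral_withDensity_eq_integral_toReal_smul (measurable_stdNormalDensity d)
      (ae_of_all _ fun x => by simp [stdNormalDensity])]
  have h := GaussianFourier.integral_cexp_neg_mul_sq_norm_add (V := E d) (b := (1 / 2 : ℂ))
      (by norm_num) Complex.I t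
  have hc : ∀ x : E d, (stdNormalDensity d x).toReal • Complex.exp ((inner ℝ x t : ℝ) * Complex.I)
      = (((2 * Real.pi) ^ (-(d : ℝ) / 2) : ℝ) : ℂ) *
        Complex.exp (-(1 / 2 : ℂ) * (‖x‖ : ℂ) ^ 2 + Complex.I * ((inner ℝ t x : ℝ) : ℂ)) := by
    intro x
    rw [stdNormalDensity, ENNReal.toReal_ofReal (by positivity), Complex.real_smul,
      Complex.ofReal_mul, Complex.ofReal_exp, mul_assoc, ← Complex.exp_add, real_inner_comm]
    congr 2
    push_cast
    ring
  simp_rw [hc]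
  rw [integral_const_mul, h, ← mul_assoc]
  have hone : (((2 * Real.pi) ^ (-(d : ℝ) / 2) : ℝ) : ℂ) *
      ((Real.pi : ℂ) / (1 / 2)) ^ ((Module.finrank ℝ (E d) : ℂ) / 2) = 1 := by
    have e1 : ((Real.pi : ℂ) / (1 / 2)) = ((2 * Real.pi : ℝ) : ℂ) := by push_cast; ring
    have e2 : ((Module.finrank ℝ (E d) : ℂ) / 2) = (((d : ℝ) / 2 : ℝ) : ℂ) := by simp
    rw [e1, e2, ← Complex.ofReal_cpow hpos.le, ← Complex.ofReal_mul, ← Real.rpow_add hpos]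
    simp [neg_div]
  rw [hone, one_mul]
  congr 1
  rw [Complex.I_sq]
  ring

lemma map_neg_stdGaussian (d : ℕ) : (stdGaussian (E d)).map (fun x => -x) = stdGaussian (E d) :=
  stdGaussian_map (LinearIsometryEquiv.neg ℝ (E := E d))

lemma map_smul_add_smul_stdGaussian (d : ℕ) (a b c : ℝ) (h : a ^ 2 + b ^ 2 = c ^ 2) :
    ((stdGaussian (E d)).prod (stdGaussian (E d))).map (fun p => a • p.1 + b • p.2) =
      (stdGaussian (E d)).map (fun x => c • x) := by
  have h1 : ((stdGaussian (E d)).prod (stdGaussian (E d))).map (fun p => a • p.1 + b • p.2) =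
      ((stdGaussian (E d)).map (fun x => a • x)) ∗ ((stdGaussian (E d)).map (fun x => b • x)) := by
    rw [Measure.conv, Measure.map_prod_map _ _ (by fun_prop) (by fun_prop),
      Measure.map_map (by fun_prop) (by fun_prop)]
    rfl
  have i1 : IsProbabilityMeasure ((stdGaussian (E d)).map (fun x => a • x)) :=
    Measure.isProbabilityMeasure_map (by fun_prop)
  have i2 : IsProbabilityMeasure ((stdGaussian (E d)).map (fun x => b • x)) :=
    Measure.isProbabilityMeasure_map (by fun_prop)
  have i3 : IsProbabilityMeasure ((stdGaussian (E d)).map (fun x => c • x)) :=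
    Measure.isProbabilityMeasure_map (by fun_prop)
  rw [h1]
  refine Measure.ext_of_charFun ?_
  ext t
  rw [charFun_conv, charFun_map_smul, charFun_map_smul, charFun_map_smul, charFun_stdGaussian,
    charFun_stdGaussian, charFun_stdGaussian, ← Complex.exp_add]
  congr 1
  simp only [norm_smul, Complex.ofReal_mul, mul_pow, ← Complex.ofReal_pow, Real.norm_eq_abs, sq_abs]
  rw [← h]
  push_cast
  ring

/-- The proposal is reversible for the standard Gaussian law: the pair `(x, y)` is exchangeable,
because `(x, w) ↦ (y, √(1 - ρ) x - √ρ w)` is an orthogonal involution. -/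
lemma map_proposal_swap (d : ℕ) {ρ : ℝ} (hρ0 : 0 ≤ ρ) (hρ1 : ρ ≤ 1) :
    ((stdGaussian (E d)).prod (stdGaussian (E d))).map (fun p => (proposal ρ p.1 p.2, p.1)) =
    ((stdGaussian (E d)).prod (stdGaussian (E d))).map (fun p => (p.1, proposal ρ p.1 p.2)) := by
  have hs : Real.sqrt (1 - ρ) = Real.sin (Real.arccos (Real.sqrt ρ)) := by
    rw [Real.sin_arccos, Real.sq_sqrt hρ0]
  have hc : Real.sqrt ρ = Real.cos (Real.arccos (Real.sqrt ρ)) := by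
    rw [Real.cos_arccos (by linarith [Real.sqrt_nonneg ρ]) (Real.sqrt_le_one.2 hρ1)]
  have hrot := IsGaussian.map_rotation_eq_self (μ := stdGaussian (E d))
    (by simp) (Real.arccos (Real.sqrt ρ))
  have hneg : ((stdGaussian (E d)).prod (stdGaussian (E d))).map (Prod.map id (fun x => -x)) =
      (stdGaussian (E d)).prod (stdGaussian (E d)) := by
    rw [← Measure.map_prod_map _ _ measurable_id (by fun_prop), Measure.map_id, map_neg_stdGaussian]
  have hm := measurable_proposal (d := d) ρ
  conv_rhs => rw [← hneg, ← hrot]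
  rw [Measure.map_map (by fun_prop) (by fun_prop), Measure.map_map (by fun_prop) (by fun_prop)]
  congr 1
  funext p
  simp only [Function.comp_apply, ContinuousLinearMap.rotation_apply, Prod.map, id, ← hs, ← hc,
    proposal, Prod.mk.injEq, true_and]
  have h1 : Real.sqrt ρ * Real.sqrt ρ = ρ := Real.mul_self_sqrt hρ0
  have h2 : Real.sqrt (1 - ρ) * Real.sqrt (1 - ρ) = 1 - ρ := Real.mul_self_sqrt (by linarith)
  have h3 : p.1 = (Real.sqrt ρ * Real.sqrt ρ + Real.sqrt (1 - ρ) * Real.sqrt (1 - ρ)) • p.1 := by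
    rw [h1, h2]; simp
  conv_lhs => rw [h3]
  module

/-! ### Exponential concentration of the proposal -/

/-- Chernoff's bound in qualitative form: the moment generating function of a variable with negative
mean takes a value below `1` at some positive argument. -/
lemma exists_pow_bound_sum_nonneg (μ : Measure ℝ) [IsProbabilityMeasure μ] (g : ℝ → ℝ)
    (h0 : 0 ∈ interior (integrableExpSet g μ)) (hneg : ∫ x, g x ∂μ < 0) :
    ∃ c : ℝ, 0 ≤ c ∧ c < 1 ∧ ∀ d : ℕ,
      (Measure.pi fun _ : Fin d => μ).real {x | 0 ≤ ∑ i, g (x i)} ≤ c ^ d := by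
  have hd : HasDerivAt (mgf g μ) (∫ x, g x ∂μ) 0 := by
    simpa using hasDerivAt_mgf h0
  have hev : ∀ᶠ t in 𝓝[>] (0 : ℝ), slope (mgf g μ) 0 t < 0 :=
    ((hasDerivAt_iff_tendsto_slope.1 hd).mono_left
      (nhdsWithin_mono _ fun x hx => ne_of_gt hx)).eventually_lt_const hneg
  have hin : ∀ᶠ t in 𝓝[>] (0 : ℝ), t ∈ integrableExpSet g μ :=
    nhdsWithin_le_nhds (mem_interior_iff_mem_nhds.1 h0)
  obtain ⟨t, ⟨ht1, ht2⟩, ht0⟩ := ((hev.and hin).and self_mem_nhdsWithin).exists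
  have ht0 : 0 < t := ht0
  refine ⟨mgf g μ t, mgf_nonneg, ?_, fun d => ?_⟩
  · rw [slope_def_field, sub_zero, mgf_zero, div_neg_iff] at ht1
    rcases ht1 with h | h <;> linarith [h.1, h.2]
  · have hprod : ∀ x : Fin d → ℝ, Real.exp (t * ∑ i, g (x i)) = ∏ i, Real.exp (t * g (x i)) := by
      intro x
      rw [Finset.mul_sum, Real.exp_sum]
    have hint : Integrable (fun x : Fin d → ℝ => Real.exp (t * ∑ i, g (x i)))
        (Measure.pi fun _ => μ) := by
      simp_rw [hprod]
      exact Integrable.fintype_prod (f := fun _ x => Real.exp (t * g x)) fun _ => ht2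
    refine (measure_ge_le_exp_mul_mgf 0 ht0.le hint).trans ?_
    rw [mul_zero, Real.exp_zero, one_mul, mgf]
    simp_rw [hprod]
    rw [integral_fintype_prod_eq_prod (fun _ x => Real.exp (t * g x))]
    simp [mgf]

lemma zero_mem_interior_integrableExpSet_sq (a b : ℝ) :
    0 ∈ interior (integrableExpSet (fun x : ℝ => a * x ^ 2 + b) (gaussianReal 0 1)) := by
  obtain ⟨C, hC, hint⟩ := IsGaussian.exists_integrable_exp_sq (gaussianReal 0 1)
  rw [mem_interior_iff_mem_nhds]
  have h1 : ∀ᶠ t in 𝓝 (0 : ℝ), t * a < C := by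
    have : Tendsto (fun t : ℝ => t * a) (𝓝 0) (𝓝 (0 * a)) := tendsto_id.mul_const a
    exact this.eventually_lt_const (by simpa using hC)
  filter_upwards [h1] with t ht
  refine (hint.const_mul (Real.exp (t * b))).mono' (by fun_prop) (ae_of_all _ fun x => ?_)
  rw [Real.norm_eq_abs, abs_of_pos (Real.exp_pos _), ← Real.exp_add]
  refine Real.exp_le_exp.2 ?_
  rw [Real.norm_eq_abs, sq_abs]
  nlinarith [sq_nonneg x]

lemma integral_sq_gaussianReal_zero_one : ∫ x : ℝ, x ^ 2 ∂(gaussianReal 0 1) = 1 := by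
  have h := variance_id_gaussianReal (μ := 0) (v := 1)
  rw [variance_of_integral_eq_zero aemeasurable_id (by simp)] at h
  simpa using h

lemma integrable_sq_gaussianReal_zero_one : Integrable (fun x : ℝ => x ^ 2) (gaussianReal 0 1) :=
  (IsGaussian.memLp_two_id (μ := gaussianReal 0 1)).integrable_sq

lemma stdGaussian_real_eq_pi (d : ℕ) {s : Set (E d)} (hs : MeasurableSet s) :
    (stdGaussian (E d)).real s =
      (Measure.pi fun _ : Fin d => gaussianReal 0 1).real {x | WithLp.toLp 2 x ∈ s} := by
  rw [← map_pi_eq_stdGaussian, map_measureReal_apply (by fun_prop) hs]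
  rfl

/-- Concentration of `‖w‖²` around `d` at an exponential rate in `d`. -/
lemma exists_pow_bound_norm_sq {δ : ℝ} (hδ : 0 < δ) :
    ∃ c : ℝ, 0 ≤ c ∧ c < 1 ∧ ∀ d : ℕ,
      (stdGaussian (E d)).real {w | δ * d < |‖w‖ ^ 2 - d|} ≤ 2 * c ^ d := by
  have hi := integrable_sq_gaussianReal_zero_one
  have key : ∀ a b : ℝ, a + b < 0 → ∃ c : ℝ, 0 ≤ c ∧ c < 1 ∧ ∀ d : ℕ,
      (stdGaussian (E d)).real {w | 0 ≤ a * ‖w‖ ^ 2 + b * d} ≤ c ^ d := by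
    intro a b hab
    obtain ⟨c, h0, h1, h⟩ := exists_pow_bound_sum_nonneg (gaussianReal 0 1)
      (fun x : ℝ => a * x ^ 2 + b) (zero_mem_interior_integrableExpSet_sq a b) (by
        rw [integral_add (hi.const_mul a) (integrable_const b), integral_const_mul,
          integral_sq_gaussianReal_zero_one]
        simpa using hab)
    refine ⟨c, h0, h1, fun d => ?_⟩
    rw [stdGaussian_real_eq_pi d (measurableSet_le (by fun_prop) (by fun_prop))]
    refine le_of_eq_of_le ?_ (h d)
    congr 1
    ext x
    simp [EuclideanSpace.real_norm_sq_eq, Finset.sum_add_distrib, Finset.mul_sum, mul_comm]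
  obtain ⟨c, h0, h1, h⟩ := key 1 (-(1 + δ)) (by linarith)
  obtain ⟨c', h0', h1', h'⟩ := key (-1) (1 - δ) (by linarith)
  refine ⟨max c c', le_max_of_le_left h0, max_lt h1 h1', fun d => ?_⟩
  have hsub : {w : E d | δ * d < |‖w‖ ^ 2 - d|} ⊆
      {w | 0 ≤ 1 * ‖w‖ ^ 2 + -(1 + δ) * d} ∪ {w | 0 ≤ -1 * ‖w‖ ^ 2 + (1 - δ) * d} := by
    intro w hw
    rcases lt_abs.1 (Set.mem_ofPred.1 hw) with hw | hw
    · left; simp only [Set.mem_ofPred_eq]; linarith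
    · right; simp only [Set.mem_ofPred_eq]; linarith
  refine (measureReal_mono hsub).trans ((measureReal_union_le _ _).trans ?_)
  have := pow_le_pow_left₀ h0 (le_max_left c c') d
  have := pow_le_pow_left₀ h0' (le_max_right c c') d
  linarith [h d, h' d]

lemma map_inner_stdGaussian (d : ℕ) (x : E d) :
    (stdGaussian (E d)).map (fun w => inner ℝ x w) = gaussianReal 0 (‖x‖₊ ^ 2) := by
  have h := IsGaussian.map_eq_gaussianReal (μ := stdGaussian (E d)) (innerSL ℝ x)
  rw [integral_strongDual_stdGaussian, variance_dual_stdGaussian, innerSL_apply_norm] at h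
  have e : (‖x‖ ^ 2).toNNReal = ‖x‖₊ ^ 2 := by
    rw [← coe_nnnorm, ← NNReal.coe_pow, Real.toNNReal_coe]
  rw [e] at h
  exact h

lemma stdGaussian_inner_gt_le (d : ℕ) (x : E d) {s : ℝ} (hs : 0 ≤ s) :
    (stdGaussian (E d)).real {w | s * ‖x‖ < |inner ℝ x w|} ≤ 2 * Real.exp (-s ^ 2 / 2) := by
  rcases eq_or_ne x 0 with rfl | hx
  · simp
    positivity
  have hx' : 0 < ‖x‖ := norm_pos_iff.2 hx
  have key : ∀ y : E d, ‖y‖ = ‖x‖ → (stdGaussian (E d)).real {w | s * ‖x‖ ≤ inner ℝ y w} ≤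
      Real.exp (-s ^ 2 / 2) := by
    intro y hy
    have hm := map_inner_stdGaussian d y
    have hint : Integrable (fun w => Real.exp (s / ‖x‖ * inner ℝ y w)) (stdGaussian (E d)) := by
      have h := integrable_exp_mul_gaussianReal (μ := 0) (v := ‖y‖₊ ^ 2) (s / ‖x‖)
      rw [← hm, integrable_map_measure (by fun_prop) (by fun_prop)] at h
      exact h
    refine (measure_ge_le_exp_mul_mgf (s * ‖x‖) (by positivity) hint).trans ?_
    rw [mgf_gaussianReal hm, ← Real.exp_add]
    refine Real.exp_le_exp.2 (le_of_eq ?_)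
    push_cast
    rw [hy]
    field_simp
    ring
  have hsub : {w : E d | s * ‖x‖ < |inner ℝ x w|} ⊆
      {w | s * ‖x‖ ≤ inner ℝ x w} ∪ {w | s * ‖x‖ ≤ inner ℝ (-x) w} := by
    intro w hw
    rcases lt_abs.1 (Set.mem_ofPred.1 hw) with hw | hw
    · exact Or.inl hw.le
    · right; simp only [Set.mem_ofPred_eq, inner_neg_left]; exact hw.le
  refine (measureReal_mono hsub).trans ((measureReal_union_le _ _).trans ?_)
  linarith [key x rfl, key (-x) (norm_neg x)]

lemma norm_sq_proposal {d : ℕ} {ρ : ℝ} (hρ0 : 0 ≤ ρ) (hρ1 : ρ ≤ 1) (x w : E d) :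
    ‖proposal ρ x w‖ ^ 2 =
      ρ * ‖x‖ ^ 2 + 2 * (Real.sqrt ρ * Real.sqrt (1 - ρ)) * inner ℝ x w + (1 - ρ) * ‖w‖ ^ 2 := by
  rw [proposal, norm_add_sq_real, norm_smul, norm_smul, real_inner_smul_left, real_inner_smul_right,
    mul_pow, mul_pow, Real.norm_eq_abs, Real.norm_eq_abs, sq_abs, sq_abs, Real.sq_sqrt hρ0,
    Real.sq_sqrt (by linarith : 0 ≤ 1 - ρ)]
  ring

/-- The pairs `(x, y)` whose squared norms fail the approximate relation
`‖y‖² ≈ ρ ‖x‖² + (1 - ρ) d`. -/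
def offDrift (ρ δ : ℝ) (d : ℕ) : Set (E d × E d) :=
  {p | δ * (d + ‖p.1‖ ^ 2) < |‖p.2‖ ^ 2 - ρ * ‖p.1‖ ^ 2 - (1 - ρ) * d|}

lemma measurableSet_offDrift (ρ δ : ℝ) (d : ℕ) : MeasurableSet (offDrift ρ δ d) :=
  measurableSet_lt (by fun_prop) (by fun_prop)

/-- Because the tolerance in `offDrift` grows with `‖x‖²`, the bound is uniform in the starting point,
and no control of the tails of the target is needed. -/
lemma exists_pow_bound_offDrift {ρ : ℝ} (hρ0 : 0 ≤ ρ) (hρ1 : ρ ≤ 1) {δ : ℝ} (hδ : 0 < δ) :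
    ∃ c : ℝ, 0 ≤ c ∧ c < 1 ∧ ∀ (d : ℕ) (x : E d),
      (stdGaussian (E d)).real {w | (x, proposal ρ x w) ∈ offDrift ρ δ d} ≤ 4 * c ^ d := by
  obtain ⟨c, h0, h1, h⟩ := exists_pow_bound_norm_sq (half_pos hδ)
  have he : Real.exp (-δ ^ 2 / 2) < 1 := Real.exp_lt_one_iff.2 (by nlinarith)
  refine ⟨max c (Real.exp (-δ ^ 2 / 2)), le_max_of_le_left h0, max_lt h1 he, fun d x => ?_⟩
  have hsub : {w : E d | (x, proposal ρ x w) ∈ offDrift ρ δ d} ⊆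
      {w | δ / 2 * d < |‖w‖ ^ 2 - d|} ∪ {w | δ * Real.sqrt d * ‖x‖ < |inner ℝ x w|} := by
    intro w hw
    by_contra hcon
    simp only [Set.mem_union, Set.mem_ofPred_eq, not_or, not_lt] at hcon
    obtain ⟨ha, hb⟩ := hcon
    simp only [offDrift, Set.mem_ofPred_eq, norm_sq_proposal hρ0 hρ1] at hw
    have hk0 : 0 ≤ Real.sqrt ρ * Real.sqrt (1 - ρ) := by positivity
    have hk1 : 2 * (Real.sqrt ρ * Real.sqrt (1 - ρ)) ≤ 1 := by
      nlinarith [sq_nonneg (Real.sqrt ρ - Real.sqrt (1 - ρ)), Real.sq_sqrt hρ0,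
        Real.sq_sqrt (by linarith : 0 ≤ 1 - ρ)]
    have hd : (0 : ℝ) ≤ d := Nat.cast_nonneg d
    -- The cross term is absorbed by the tolerance through `2 √d ‖x‖ ≤ d + ‖x‖²`.
    have hamgm : 2 * (Real.sqrt d * ‖x‖) ≤ d + ‖x‖ ^ 2 := by
      nlinarith [sq_nonneg (Real.sqrt d - ‖x‖), Real.sq_sqrt hd]
    have hle : |ρ * ‖x‖ ^ 2 + 2 * (Real.sqrt ρ * Real.sqrt (1 - ρ)) * inner ℝ x w +
        (1 - ρ) * ‖w‖ ^ 2 - ρ * ‖x‖ ^ 2 - (1 - ρ) * d| ≤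
        1 * |inner ℝ x w| + 1 * |‖w‖ ^ 2 - d| := by
      have : ρ * ‖x‖ ^ 2 + 2 * (Real.sqrt ρ * Real.sqrt (1 - ρ)) * inner ℝ x w +
        (1 - ρ) * ‖w‖ ^ 2 - ρ * ‖x‖ ^ 2 - (1 - ρ) * d =
        2 * (Real.sqrt ρ * Real.sqrt (1 - ρ)) * inner ℝ x w + (1 - ρ) * (‖w‖ ^ 2 - d) := by ring
      rw [this]
      refine (abs_add_le _ _).trans (add_le_add ?_ ?_)
      · rw [abs_mul]
        refine mul_le_mul_of_nonneg_right ?_ (abs_nonneg _)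
        rwa [abs_of_nonneg (by positivity)]
      · rw [abs_mul]
        refine mul_le_mul_of_nonneg_right ?_ (abs_nonneg _)
        rw [abs_of_nonneg (by linarith)]
        linarith
    nlinarith [sq_nonneg ‖x‖]
  refine (measureReal_mono hsub).trans ((measureReal_union_le _ _).trans ?_)
  have hb := stdGaussian_inner_gt_le d x (s := δ * Real.sqrt d) (by positivity)
  have hexp : Real.exp (-(δ * Real.sqrt d) ^ 2 / 2) = Real.exp (-δ ^ 2 / 2) ^ d := by
    rw [← Real.exp_nat_mul, mul_pow, Real.sq_sqrt (Nat.cast_nonneg d)]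
    congr 1
    ring
  rw [hexp] at hb
  have := pow_le_pow_left₀ h0 (le_max_left c (Real.exp (-δ ^ 2 / 2))) d
  have := pow_le_pow_left₀ (Real.exp_pos _).le (le_max_right c (Real.exp (-δ ^ 2 / 2))) d
  linarith [h d]

/-- The map `r ↦ ρ r + (1 - ρ)` has no cycle of length two besides its fixed point `1`: squared norms
that follow the drift in both directions are close to `d`. The tolerance is small enough compared
with the contraction factor `1 - ρ²` of two steps to make this distance less than `η d`. -/
lemma abs_norm_sq_sub_lt_of_not_offDrift {ρ : ℝ} (hρ0 : 0 ≤ ρ) (hρ1 : ρ < 1) {η : ℝ} (hη : 0 < η)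
    (hη1 : η ≤ 1) {d : ℕ} (hd : 0 < d) {x y : E d}
    (hxy : (x, y) ∉ offDrift ρ (η * (1 - ρ ^ 2) / 12) d)
    (hyx : (y, x) ∉ offDrift ρ (η * (1 - ρ ^ 2) / 12) d) : |‖x‖ ^ 2 - d| < η * d := by
  simp only [offDrift, Set.mem_ofPred_eq, not_lt] at hxy hyx
  have hd' : (0 : ℝ) < d := Nat.cast_pos.2 hd
  have hκ : 0 < 1 - ρ ^ 2 := by nlinarith
  have hκ1 : 1 - ρ ^ 2 ≤ 1 := by nlinarith
  set κ := 1 - ρ ^ 2 with hκdef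
  set δ := η * κ / 12 with hδdef
  set u := ‖x‖ ^ 2 - d with hu
  set v := ‖y‖ ^ 2 - d with hv
  have hδ0 : 0 < δ := by positivity
  have hδ1 : δ ≤ κ / 12 := by rw [hδdef]; gcongr; nlinarith
  have e1 : |v - ρ * u| ≤ δ * (2 * d + |u|) := by
    refine (le_of_eq ?_).trans (hxy.trans (mul_le_mul_of_nonneg_left ?_ hδ0.le))
    · congr 1; rw [hu, hv]; ring
    · linarith [le_abs_self u]
  have e2 : |u - ρ * v| ≤ δ * (2 * d + |v|) := by
    refine (le_of_eq ?_).trans (hyx.trans (mul_le_mul_of_nonneg_left ?_ hδ0.le))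
    · congr 1; rw [hu, hv]; ring
    · linarith [le_abs_self v]
  have hv' : |v| ≤ |u| + δ * (2 * d + |u|) := by
    have : |v| ≤ |v - ρ * u| + |ρ * u| := by simpa using abs_add_le (v - ρ * u) (ρ * u)
    rw [abs_mul, abs_of_nonneg hρ0] at this
    nlinarith [abs_nonneg u]
  -- Composing the two approximate relations gives `u ≈ ρ² u`.
  have hu' : κ * |u| ≤ δ * (2 * d + |v|) + δ * (2 * d + |u|) := by
    have h1 : |κ * u| ≤ |u - ρ * v| + |ρ * (v - ρ * u)| := by
      have := abs_add_le (u - ρ * v) (ρ * (v - ρ * u))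
      rwa [show u - ρ * v + ρ * (v - ρ * u) = κ * u by rw [hκdef]; ring] at this
    rw [abs_mul, abs_mul, abs_of_pos hκ, abs_of_nonneg hρ0] at h1
    nlinarith [abs_nonneg (v - ρ * u)]
  have h3 : κ * |u| ≤ 3 * δ * (2 * d + |u|) := by
    have : δ * (δ * (2 * d + |u|)) ≤ 1 * (δ * (2 * d + |u|)) := by
      refine mul_le_mul_of_nonneg_right (by linarith) (by positivity)
    nlinarith [mul_le_mul_of_nonneg_left hv' hδ0.le]
  have h4 : 3 * δ * |u| ≤ κ / 4 * |u| := mul_le_mul_of_nonneg_right (by linarith) (abs_nonneg u)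
  have h5 : κ * |u| < κ * (η * d) := by
    have h6 : 6 * δ * d = κ * (η * d) / 2 := by rw [hδdef]; ring
    have h7 : 0 < κ * (η * d) := by positivity
    nlinarith
  exact lt_of_mul_lt_mul_left h5 hκ.le

/-! ### Detailed balance and rare acceptance -/

lemma stdGaussian_absolutelyContinuous (d : ℕ) : stdGaussian (E d) ≪ volume := by
  rw [stdGaussian_eq_withDensity]
  exact withDensity_absolutelyContinuous _ _

lemma scaleMixture_absolutelyContinuous {Q : Measure ℝ} [IsProbabilityMeasure Q]
    (hQ : Q (Set.Iic 0) = 0) (d : ℕ) : scaleMixture Q d ≪ volume := by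
  refine Measure.AbsolutelyContinuous.mk fun s hs hs0 => ?_
  have hm : Measurable (fun zw : ℝ × E d => Real.sqrt zw.1 • zw.2) := by fun_prop
  rw [scaleMixture, Measure.map_apply hm hs, Measure.prod_apply (hm hs), lintegral_eq_zero_iff
    (measurable_measure_prodMk_left (hm hs))]
  have hpos : ∀ᵐ z ∂Q, 0 < z := by
    rw [ae_iff]
    simpa [Set.Iic] using hQ
  filter_upwards [hpos] with z hz
  refine stdGaussian_absolutelyContinuous d ?_
  have := Measure.addHaar_preimage_smul (volume : Measure (E d)) (Real.sqrt_pos.2 hz).ne' s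
  rw [hs0, mul_zero] at this
  exact this

lemma stdNormalDensity_ne_zero (d : ℕ) (x : E d) : stdNormalDensity d x ≠ 0 := by
  rw [stdNormalDensity, Ne, ENNReal.ofReal_eq_zero, not_le]
  positivity

lemma stdNormalDensity_ne_top (d : ℕ) (x : E d) : stdNormalDensity d x ≠ ∞ :=
  ENNReal.ofReal_ne_top

/-- The density of `P` with respect to the standard normal distribution. -/
noncomputable def gaussianDensity {d : ℕ} (P : Measure (E d)) (x : E d) : ℝ≥0∞ :=
  P.rnDeriv volume x / stdNormalDensity d x

lemma measurable_gaussianDensity {d : ℕ} (P : Measure (E d)) : Measurable (gaussianDensity P) :=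
  (Measure.measurable_rnDeriv P volume).div (measurable_stdNormalDensity d)

lemma withDensity_gaussianDensity {d : ℕ} (P : Measure (E d)) [IsProbabilityMeasure P]
    (hP : P ≪ volume) : (stdGaussian (E d)).withDensity (gaussianDensity P) = P := by
  rw [stdGaussian_eq_withDensity, ← withDensity_mul _ (measurable_stdNormalDensity d)
    (measurable_gaussianDensity P)]
  have : stdNormalDensity d * gaussianDensity P = P.rnDeriv volume := by
    funext x
    exact ENNReal.mul_div_cancel (stdNormalDensity_ne_zero d x) (stdNormalDensity_ne_top d x)
  rw [this, Measure.withDensity_rnDeriv_eq _ _ hP]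

lemma lintegral_eq_lintegral_gaussianDensity_mul {d : ℕ} (P : Measure (E d))
    [IsProbabilityMeasure P] (hP : P ≪ volume) {F : E d → ℝ≥0∞} (hF : Measurable F) :
    ∫⁻ x, F x ∂P = ∫⁻ x, gaussianDensity P x * F x ∂(stdGaussian (E d)) := by
  have h := lintegral_withDensity_eq_lintegral_mul (stdGaussian (E d))
    (measurable_gaussianDensity P) hF
  rw [withDensity_gaussianDensity P hP] at h
  exact h

/-- One half of the detailed balance relation
`h(x) α(x, y) = h(y) α(y, x)`, where `h` is the density of `P` with respect to the Gaussian law that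
the proposal leaves invariant. -/
lemma gaussianDensity_mul_accept_le {d : ℕ} (P : Measure (E d)) (x y : E d) :
    gaussianDensity P x * accept P x y ≤ gaussianDensity P y := by
  have hs0 := stdNormalDensity_ne_zero d x
  have hs1 := stdNormalDensity_ne_top d x
  have ht0 := stdNormalDensity_ne_zero d y
  have ht1 := stdNormalDensity_ne_top d y
  unfold gaussianDensity accept
  generalize P.rnDeriv volume x = a at *
  generalize P.rnDeriv volume y = b at *
  generalize stdNormalDensity d x = s at *
  generalize stdNormalDensity d y = t at *
  -- Where `p(x)` is `0` or `∞` the left side vanishes by the conventions of `ℝ≥0∞`.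
  rcases eq_or_ne a 0 with rfl | ha0
  · simp
  rcases eq_or_ne a ∞ with rfl | ha1
  · simp [ENNReal.top_mul ht0]
  refine (mul_le_mul_right (min_le_right _ _) _).trans (le_of_eq ?_)
  rw [ENNReal.div_eq_inv_mul, ENNReal.div_eq_inv_mul, ENNReal.div_eq_inv_mul,
    ENNReal.mul_inv (Or.inl ha0) (Or.inl ha1)]
  calc s⁻¹ * a * (a⁻¹ * t⁻¹ * (b * s)) = (s⁻¹ * s) * (a * a⁻¹) * (t⁻¹ * b) := by ring
    _ = t⁻¹ * b := by
      rw [ENNReal.inv_mul_cancel hs0 hs1, ENNReal.mul_inv_cancel ha0 ha1, one_mul, one_mul]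

/-- The probability of proposing and accepting a move in `C` is at most that of proposing a move in
the reversed set. -/
lemma lintegral_accept_le {d : ℕ} {ρ : ℝ} (hρ0 : 0 ≤ ρ) (hρ1 : ρ ≤ 1) (P : Measure (E d))
    [IsProbabilityMeasure P] (hP : P ≪ volume) {C : Set (E d × E d)} (hC : MeasurableSet C) :
    ∫⁻ x, ∫⁻ w, C.indicator (fun q => accept P q.1 q.2) (x, proposal ρ x w) ∂(stdGaussian (E d)) ∂P
      ≤ (P.prod (stdGaussian (E d))) ((fun p => (proposal ρ p.1 p.2, p.1)) ⁻¹' C) := by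
  have hprop := measurable_proposal (d := d) ρ
  have hh := measurable_gaussianDensity P
  have hpair : Measurable (fun p : E d × E d => (p.1, proposal ρ p.1 p.2)) := by fun_prop
  have hpair' : Measurable (fun p : E d × E d => (proposal ρ p.1 p.2, p.1)) := by fun_prop
  have hacc : Measurable (fun q : E d × E d => C.indicator (fun q => accept P q.1 q.2) q) :=
    (measurable_accept P).indicator hC
  have hF : Measurable (fun q : E d × E d => C.indicator (fun q => gaussianDensity P q.2) q) :=
    (hh.comp measurable_snd).indicator hC
  have hF1 : Measurable (fun p : E d × E d =>
      C.indicator (fun q => gaussianDensity P q.2) (p.1, proposal ρ p.1 p.2)) := hF.comp hpair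
  have hF2 : Measurable (fun p : E d × E d =>
      C.indicator (fun q => gaussianDensity P q.2) (proposal ρ p.1 p.2, p.1)) := hF.comp hpair'
  have hone : Measurable (fun p : E d × E d =>
      C.indicator (1 : E d × E d → ℝ≥0∞) (proposal ρ p.1 p.2, p.1)) :=
    (measurable_one.indicator hC).comp hpair'
  have hacc' : Measurable (fun p : E d × E d =>
      C.indicator (fun q => accept P q.1 q.2) (p.1, proposal ρ p.1 p.2)) := hacc.comp hpair
  rw [lintegral_eq_lintegral_gaussianDensity_mul P hP hacc'.lintegral_prod_right']
  calc ∫⁻ x, gaussianDensity P x * ∫⁻ w, C.indicator (fun q => accept P q.1 q.2)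
          (x, proposal ρ x w) ∂(stdGaussian (E d)) ∂(stdGaussian (E d))
      = ∫⁻ x, ∫⁻ w, gaussianDensity P x * C.indicator (fun q => accept P q.1 q.2)
          (x, proposal ρ x w) ∂(stdGaussian (E d)) ∂(stdGaussian (E d)) := by
        refine lintegral_congr fun x => ?_
        rw [lintegral_const_mul]
        exact hacc'.comp measurable_prodMk_left
    _ ≤ ∫⁻ x, ∫⁻ w, C.indicator (fun q => gaussianDensity P q.2)
          (x, proposal ρ x w) ∂(stdGaussian (E d)) ∂(stdGaussian (E d)) := by
        refine lintegral_mono fun x => lintegral_mono fun w => ?_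
        by_cases hc : (x, proposal ρ x w) ∈ C
        · simpa [hc] using gaussianDensity_mul_accept_le P x (proposal ρ x w)
        · simp [hc]
    _ = ∫⁻ p, C.indicator (fun q => gaussianDensity P q.2) (p.1, proposal ρ p.1 p.2)
          ∂((stdGaussian (E d)).prod (stdGaussian (E d))) := by
        rw [lintegral_prod _ hF1.aemeasurable]
    _ = ∫⁻ p, C.indicator (fun q => gaussianDensity P q.2) (proposal ρ p.1 p.2, p.1)
          ∂((stdGaussian (E d)).prod (stdGaussian (E d))) := by
        rw [← lintegral_map hF hpair, ← map_proposal_swap d hρ0 hρ1, lintegral_map hF hpair']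
    _ = ∫⁻ x, gaussianDensity P x * ∫⁻ w, C.indicator 1 (proposal ρ x w, x)
          ∂(stdGaussian (E d)) ∂(stdGaussian (E d)) := by
        rw [lintegral_prod _ hF2.aemeasurable]
        refine lintegral_congr fun x => ?_
        have hx : Measurable (fun w => C.indicator (1 : E d × E d → ℝ≥0∞) (proposal ρ x w, x)) :=
          hone.comp measurable_prodMk_left
        rw [← lintegral_const_mul _ hx]
        refine lintegral_congr fun w => ?_
        by_cases hc : (proposal ρ x w, x) ∈ C <;> simp [hc]
    _ = ∫⁻ x, ∫⁻ w, C.indicator 1 (proposal ρ x w, x) ∂(stdGaussian (E d)) ∂P := by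
        rw [lintegral_eq_lintegral_gaussianDensity_mul P hP hone.lintegral_prod_right']
    _ = (P.prod (stdGaussian (E d))) ((fun p => (proposal ρ p.1 p.2, p.1)) ⁻¹' C) := by
        rw [Measure.prod_apply (hpair' hC)]
        refine lintegral_congr fun x => ?_
        rw [← lintegral_indicator_one ((hpair' hC).preimage measurable_prodMk_left)]
        rfl

lemma accept_le_one {d : ℕ} (P : Measure (E d)) (x y : E d) : accept P x y ≤ 1 := min_le_left _ _

/-- If a move between `x ∈ A` and `y` always puts `(x, y)` or `(y, x)` in a set `O` that is rare for
the proposal, then few proposals from `A` are accepted: by detailed balance, accepting a move that is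
rare backwards is as unlikely as a move that is rare forwards. -/
lemma setLIntegral_accept_le {d : ℕ} {ρ : ℝ} (hρ0 : 0 ≤ ρ) (hρ1 : ρ ≤ 1) (P : Measure (E d))
    [IsProbabilityMeasure P] (hP : P ≪ volume) {A : Set (E d)} (hA : MeasurableSet A)
    {O : Set (E d × E d)} (hO : MeasurableSet O) (hAO : ∀ x ∈ A, ∀ y, (x, y) ∈ O ∨ (y, x) ∈ O)
    {b : ℝ≥0∞} (hb : ∀ x, stdGaussian (E d) {w | (x, proposal ρ x w) ∈ O} ≤ b) :
    ∫⁻ x in A, ∫⁻ w, accept P x (proposal ρ x w) ∂(stdGaussian (E d)) ∂P ≤ b + b := by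
  have hprop := measurable_proposal (d := d) ρ
  have hpair : Measurable (fun p : E d × E d => (p.1, proposal ρ p.1 p.2)) := by fun_prop
  have hOs : MeasurableSet (Prod.swap ⁻¹' O) := measurable_swap hO
  have hbound : (P.prod (stdGaussian (E d))) ((fun p => (p.1, proposal ρ p.1 p.2)) ⁻¹' O) ≤ b := by
    rw [Measure.prod_apply (hpair hO)]
    calc _ ≤ ∫⁻ _, b ∂P := lintegral_mono fun x => hb x
      _ = b := by simp
  have hm : ∀ {C : Set (E d × E d)}, MeasurableSet C → Measurable (fun p : E d × E d =>
      C.indicator (fun q => accept P q.1 q.2) (p.1, proposal ρ p.1 p.2)) := fun hC =>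
    ((measurable_accept P).indicator hC).comp hpair
  calc ∫⁻ x in A, ∫⁻ w, accept P x (proposal ρ x w) ∂(stdGaussian (E d)) ∂P
      ≤ ∫⁻ x in A, ∫⁻ w, (O.indicator (fun q => accept P q.1 q.2) (x, proposal ρ x w) +
          (Prod.swap ⁻¹' O).indicator (fun q => accept P q.1 q.2)
            (x, proposal ρ x w)) ∂(stdGaussian (E d)) ∂P := by
        refine setLIntegral_mono_ae' hA (ae_of_all _ fun x hx => lintegral_mono fun w => ?_)
        rcases hAO x hx (proposal ρ x w) with h | h
        · rw [Set.indicator_of_mem h]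
          exact le_self_add
        · rw [Set.indicator_of_mem (show (x, proposal ρ x w) ∈ Prod.swap ⁻¹' O from h)]
          exact le_add_self
    _ ≤ ∫⁻ x, ∫⁻ w, (O.indicator (fun q => accept P q.1 q.2) (x, proposal ρ x w) +
          (Prod.swap ⁻¹' O).indicator (fun q => accept P q.1 q.2)
            (x, proposal ρ x w)) ∂(stdGaussian (E d)) ∂P := setLIntegral_le_lintegral _ _
    _ = ∫⁻ x, ∫⁻ w, O.indicator (fun q => accept P q.1 q.2) (x, proposal ρ x w)
            ∂(stdGaussian (E d)) ∂P +
        ∫⁻ x, ∫⁻ w, (Prod.swap ⁻¹' O).indicator (fun q => accept P q.1 q.2)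
            (x, proposal ρ x w) ∂(stdGaussian (E d)) ∂P := by
        rw [← lintegral_add_left (hm hO).lintegral_prod_right']
        refine lintegral_congr fun x => ?_
        rw [lintegral_add_left]
        exact (hm hO).comp measurable_prodMk_left
    _ ≤ b + b := by
        refine add_le_add (le_trans ?_ hbound)
          ((lintegral_accept_le hρ0 hρ1 P hP hOs).trans hbound)
        rw [Measure.prod_apply (hpair hO)]
        refine lintegral_mono fun x => ?_
        rw [← lintegral_indicator_one ((hpair hO).preimage measurable_prodMk_left)]
        refine lintegral_mono fun w => ?_
        by_cases h1 : (x, proposal ρ x w) ∈ O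
        · simpa [h1] using accept_le_one P _ _
        · simp [h1]

/-- Off the unit shell, acceptance has exponentially small probability, for any target with a
density. -/
lemma exists_pow_bound_lintegral_accept {ρ : ℝ} (hρ0 : 0 ≤ ρ) (hρ1 : ρ < 1) {η : ℝ} (hη : 0 < η)
    (hη1 : η ≤ 1) :
    ∃ c : ℝ, 0 ≤ c ∧ c < 1 ∧ ∀ d : ℕ, 0 < d → ∀ (P : Measure (E d)) [IsProbabilityMeasure P],
      P ≪ volume → ∫⁻ x in {x | η * d ≤ |‖x‖ ^ 2 - d|},
        ∫⁻ w, accept P x (proposal ρ x w) ∂(stdGaussian (E d)) ∂P ≤ ENNReal.ofReal (8 * c ^ d) := by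
  have hδ : 0 < η * (1 - ρ ^ 2) / 12 := by
    have : 0 < 1 - ρ ^ 2 := by nlinarith
    positivity
  obtain ⟨c, h0, h1, h⟩ := exists_pow_bound_offDrift hρ0 hρ1.le hδ
  refine ⟨c, h0, h1, fun d hd P _ hP => ?_⟩
  refine (setLIntegral_accept_le hρ0 hρ1.le P hP
    (measurableSet_le (by fun_prop) (by fun_prop))
    (measurableSet_offDrift ρ (η * (1 - ρ ^ 2) / 12) d) (fun x hx y => ?_)
    (b := ENNReal.ofReal (4 * c ^ d)) fun x => ?_).trans (le_of_eq ?_)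
  · by_contra! hcon
    exact absurd (abs_norm_sq_sub_lt_of_not_offDrift hρ0 hρ1 hη hη1 hd hcon.1 hcon.2) (not_lt.2 hx)
  · rw [← ofReal_measureReal]
    exact ENNReal.ofReal_le_ofReal (h d x)
  · rw [← ENNReal.ofReal_add (by positivity) (by positivity)]
    congr 1
    ring

/-! ### The chain before its first acceptance -/

lemma volume_ofReal_le_le (a : ℝ≥0∞) :
    (volume : Measure unitInterval) {u | ENNReal.ofReal (u : ℝ) ≤ a} ≤ a := by
  rcases le_total 1 a with h | h
  · exact prob_le_one.trans h
  have ha : a ≠ ∞ := ne_top_of_le_ne_top ENNReal.one_ne_top h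
  have hset : {u : unitInterval | ENNReal.ofReal (u : ℝ) ≤ a} =
      Set.Iic ⟨a.toReal, ENNReal.toReal_nonneg, ENNReal.toReal_le_of_le_ofReal zero_le_one
        (by simpa using h)⟩ := by
    ext u
    rw [Set.mem_ofPred_eq, ENNReal.ofReal_le_iff_le_toReal ha]
    rfl
  rw [hset, unitInterval.volume_Iic]
  exact ENNReal.ofReal_toReal_le

/-- Until the first acceptance the chain does not move, and while it does not move each proposal is
accepted with the probability attached to the initial state. -/
lemma measure_le_pCN_stuck_add {d : ℕ} (ρ : ℝ) (P : Measure (E d)) [IsProbabilityMeasure P]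
    {B : Set (E d)} (hB : MeasurableSet B) (M : ℕ) :
    P B ≤ pCN ρ P {x | x 0 ∈ B ∧ ∀ m < M, x m = x 0} +
      M * ∫⁻ x in B, ∫⁻ w, accept P x (proposal ρ x w) ∂(stdGaussian (E d)) ∂P := by
  set ν : Measure (E d × unitInterval) := (stdGaussian (E d)).prod volume with hν
  set μ := P.prod (Measure.infinitePi (fun _ : ℕ => ν)) with hμ
  have hprop := measurable_proposal (d := d) ρ
  have hacc := measurable_accept P
  let D : Set (E d × (E d × unitInterval)) :=
    {p | p.1 ∈ B ∧ ENNReal.ofReal (p.2.2 : ℝ) ≤ accept P p.1 (proposal ρ p.1 p.2.1)}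
  have hD : MeasurableSet D := by
    refine (measurable_fst hB).inter (measurableSet_le (ENNReal.measurable_ofReal.comp
      (measurable_subtype_coe.comp (measurable_snd.comp measurable_snd))) ?_)
    exact hacc.comp (measurable_fst.prodMk (hprop.comp
      (measurable_fst.prodMk (measurable_fst.comp measurable_snd))))
  let N : ℕ → Set (E d × (ℕ → E d × unitInterval)) := fun m => {p | (p.1, p.2 m) ∈ D}
  have hN : ∀ m, μ (N m) ≤
      ∫⁻ x in B, ∫⁻ w, accept P x (proposal ρ x w) ∂(stdGaussian (E d)) ∂P := by
    intro m
    have hmp : MeasurePreserving (fun p : E d × (ℕ → E d × unitInterval) => (p.1, p.2 m)) μ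
        (P.prod ν) :=
      (MeasurePreserving.id P).prod (measurePreserving_eval_infinitePi (fun _ : ℕ => ν) m)
    have e : μ (N m) = (P.prod ν) D := hmp.measure_preimage hD.nullMeasurableSet
    rw [e, Measure.prod_apply hD, ← lintegral_indicator hB]
    refine lintegral_mono fun x => ?_
    by_cases hx : x ∈ B
    · rw [Set.indicator_of_mem hx, hν, Measure.prod_apply (hD.preimage measurable_prodMk_left)]
      refine lintegral_mono fun w => (measure_mono ?_).trans
        (volume_ofReal_le_le (accept P x (proposal ρ x w)))
      intro u hu
      exact hu.2
    · have : Prod.mk x ⁻¹' D = ∅ := by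
        ext p
        simp [D, hx]
      simp [this]
  have hsub : {p : E d × (ℕ → E d × unitInterval) | p.1 ∈ B} ⊆
      ((fun p : E d × (ℕ → E d × unitInterval) => chain ρ P p.1 p.2) ⁻¹'
        {x | x 0 ∈ B ∧ ∀ m < M, x m = x 0}) ∪ ⋃ m ∈ Finset.range M, N m := by
    intro p hp
    by_cases hcon : p ∈ ⋃ m ∈ Finset.range M, N m
    · exact Or.inr hcon
    left
    have hcon' : ∀ m < M, ¬ ENNReal.ofReal ((p.2 m).2 : ℝ) ≤
        accept P p.1 (proposal ρ p.1 (p.2 m).1) := by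
      intro m hm hle
      exact hcon (Set.mem_biUnion (Finset.mem_coe.2 (Finset.mem_range.2 hm)) ⟨hp, hle⟩)
    refine ⟨hp, fun m => ?_⟩
    induction m with
    | zero => exact fun _ => rfl
    | succ m ih =>
      intro hm
      have hcm : chain ρ P p.1 p.2 m = p.1 := ih (by omega)
      change step ρ P (chain ρ P p.1 p.2 m) (p.2 m) = p.1
      rw [hcm, step, if_neg (hcon' m (by omega))]
  have hBm : μ {p | p.1 ∈ B} = P B :=
    (measurePreserving_fst (μ := P) (ν := Measure.infinitePi (fun _ : ℕ => ν))).measure_preimage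
      hB.nullMeasurableSet
  rw [← hBm]
  refine (measure_mono hsub).trans ((measure_union_le _ _).trans (add_le_add ?_ ?_))
  · exact Measure.le_map_apply (measurable_chain ρ P).aemeasurable _
  · refine (measure_biUnion_finset_le _ _).trans ((Finset.sum_le_sum fun m _ => hN m).trans ?_)
    simp

/-! ### Failure of polynomial rates off the Gaussian case -/

lemma map_apply_stdGaussian (d : ℕ) (i : Fin d) :
    (stdGaussian (E d)).map (fun w => w i) = gaussianReal 0 1 := by
  have h := map_inner_stdGaussian d (EuclideanSpace.single i (1 : ℝ))
  simpa [EuclideanSpace.inner_single_left] using h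

lemma exists_measure_away_from_one_ne_zero {Q : Measure ℝ} [IsProbabilityMeasure Q]
    (hQ : Q (Set.Iic 0) = 0) (hne : Q ≠ Measure.dirac 1) :
    ∃ η z₀ : ℝ, 0 < η ∧ η ≤ 1 ∧ 0 < z₀ ∧ Q {z | 2 * η ≤ |z - 1| ∧ z₀ ≤ z} ≠ 0 := by
  by_contra! hcon
  apply hne
  have hz : Q {z | z ≠ 1} = 0 := by
    refine measure_mono_null (t := Set.Iic 0 ∪ ⋃ n : ℕ,
      {z | 2 * (1 / ((n : ℝ) + 1)) ≤ |z - 1| ∧ 1 / ((n : ℝ) + 1) ≤ z}) ?_ ?_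
    · intro z hz
      by_cases h0 : z ≤ 0
      · exact Or.inl h0
      right
      have h1 : 0 < |z - 1| := abs_pos.2 (sub_ne_zero.2 hz)
      obtain ⟨n, hn⟩ := exists_nat_one_div_lt (lt_min (half_pos h1) (not_le.1 h0))
      refine Set.mem_iUnion.2 ⟨n, ?_, (hn.trans_le (min_le_right _ _)).le⟩
      linarith [hn.trans_le (min_le_left _ _)]
    · refine measure_union_null hQ (measure_iUnion_null fun n => ?_)
      have hn : 0 < 1 / ((n : ℝ) + 1) := by positivity
      exact hcon _ _ hn (by rw [div_le_one (by positivity)]; simp) hn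
  have hae : ∀ᵐ z ∂Q, z = 1 := by
    rw [ae_iff]; exact hz
  calc Q = Q.map id := Measure.map_id.symm
    _ = Q.map (fun _ => 1) := Measure.map_congr hae
    _ = Measure.dirac 1 := by simp

lemma measurableSet_shell {d : ℕ} (η s : ℝ) (i : Fin d) :
    MeasurableSet {x : E d | η * d ≤ |‖x‖ ^ 2 - d| ∧ s ≤ |x i|} := by
  have h1 : MeasurableSet {x : E d | η * d ≤ |‖x‖ ^ 2 - d|} :=
    measurableSet_le (by fun_prop) (by fun_prop)
  have h2 : MeasurableSet {x : E d | s ≤ |x i|} := measurableSet_le (by fun_prop) (by fun_prop)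
  exact h1.inter h2

/-- `P_d` puts mass bounded below, uniformly in `d`, on states off the unit shell with a given
coordinate bounded away from `0`. -/
lemma exists_scaleMixture_shell_lower_bound {Q : Measure ℝ} [IsProbabilityMeasure Q]
    (hQ : Q (Set.Iic 0) = 0) {η z₀ : ℝ} (hη : 0 < η) (hη1 : η ≤ 1)
    (hne : Q {z | 2 * η ≤ |z - 1| ∧ z₀ ≤ z} ≠ 0) :
    ∃ b : ℝ≥0∞, b ≠ 0 ∧ ∀ᶠ d : ℕ in atTop, ∀ i : Fin d,
      b ≤ scaleMixture Q d {x | η * d ≤ |‖x‖ ^ 2 - d| ∧ Real.sqrt z₀ ≤ |x i|} := by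
  obtain ⟨c, h0, h1, h⟩ := exists_pow_bound_norm_sq (div_pos hη (by norm_num : (0 : ℝ) < 3))
  set κ := (gaussianReal 0 1).real {y : ℝ | 1 ≤ |y|} with hκ
  have hκ0 : 0 < κ := by
    have hne : gaussianReal 0 1 {y : ℝ | 1 ≤ |y|} ≠ 0 := by
      intro hz
      have hv := gaussianReal_absolutelyContinuous' 0 one_ne_zero hz
      have : volume (Set.Ici (1 : ℝ)) ≤ volume {y : ℝ | 1 ≤ |y|} :=
        measure_mono fun y hy => le_trans hy (le_abs_self y)
      rw [hv, Real.volume_Ici] at this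
      simp at this
    exact ENNReal.toReal_pos hne (measure_ne_top _ _)
  refine ⟨Q {z | 2 * η ≤ |z - 1| ∧ z₀ ≤ z} * ENNReal.ofReal (κ / 2),
    mul_ne_zero hne (by simpa using hκ0), ?_⟩
  have hlim : Tendsto (fun d : ℕ => 2 * c ^ d) atTop (𝓝 0) := by
    simpa using (tendsto_pow_atTop_nhds_zero_of_lt_one h0 h1).const_mul 2
  filter_upwards [hlim.eventually_lt_const (half_pos hκ0)] with d hd i
  have hm : Measurable (fun zw : ℝ × E d => Real.sqrt zw.1 • zw.2) := by fun_prop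
  have hms := measurableSet_shell η (Real.sqrt z₀) i
  -- Noise vectors of typical norm with `1 ≤ |w i|`; they suffice for every good value of `Z`.
  let V : Set (E d) := {w | 1 ≤ |w i|} \ {w | η / 3 * d < |‖w‖ ^ 2 - d|}
  have hV : ENNReal.ofReal (κ / 2) ≤ stdGaussian (E d) V := by
    rw [← ofReal_measureReal]
    refine ENNReal.ofReal_le_ofReal ?_
    have e1 : (stdGaussian (E d)).real {w | 1 ≤ |w i|} = κ := by
      rw [hκ, ← map_apply_stdGaussian d i,
        map_measureReal_apply (by fun_prop) (measurableSet_le (by fun_prop) (by fun_prop))]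
      rfl
    have e2 := le_measureReal_sdiff (μ := stdGaussian (E d)) (s₁ := {w : E d | 1 ≤ |w i|})
      (s₂ := {w | η / 3 * d < |‖w‖ ^ 2 - d|})
    have e3 := h d
    linarith
  rw [scaleMixture, Measure.map_apply hm hms]
  refine (mul_le_mul_right hV _).trans ?_
  rw [← Measure.prod_prod]
  have hposQ : ∀ᵐ p ∂(Q.prod (stdGaussian (E d))), 0 < p.1 := by
    have : ∀ᵐ z ∂Q, 0 < z := by
      rw [ae_iff]
      simpa [Set.Iic] using hQ
    exact Measure.quasiMeasurePreserving_fst.ae this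
  refine measure_mono_ae ?_
  filter_upwards [hposQ] with p hp hpm
  obtain ⟨⟨hz1, hz2⟩, hw1, hw2⟩ := hpm
  simp only [Set.mem_ofPred_eq, not_lt] at hw1 hw2
  change η * d ≤ |‖Real.sqrt p.1 • p.2‖ ^ 2 - d| ∧ Real.sqrt z₀ ≤ |(Real.sqrt p.1 • p.2) i|
  constructor
  · rw [norm_smul, mul_pow, Real.norm_eq_abs, sq_abs, Real.sq_sqrt hp.le]
    have hd0 : (0 : ℝ) ≤ d := Nat.cast_nonneg d
    have k1 : |(p.1 - 1) * ‖p.2‖ ^ 2| ≤ |p.1 * ‖p.2‖ ^ 2 - d| + |‖p.2‖ ^ 2 - d| := by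
      rw [show (p.1 - 1) * ‖p.2‖ ^ 2 = (p.1 * ‖p.2‖ ^ 2 - d) - (‖p.2‖ ^ 2 - d) by ring]
      exact abs_sub _ _
    rw [abs_mul, abs_of_nonneg (sq_nonneg ‖p.2‖)] at k1
    have k2 : 2 * η * ‖p.2‖ ^ 2 ≤ |p.1 - 1| * ‖p.2‖ ^ 2 :=
      mul_le_mul_of_nonneg_right hz1 (sq_nonneg _)
    have k3 : (1 - η / 3) * d ≤ ‖p.2‖ ^ 2 := by linarith [(abs_le.1 hw2).1]
    have k4 : 2 * η * ((1 - η / 3) * d) ≤ 2 * η * ‖p.2‖ ^ 2 :=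
      mul_le_mul_of_nonneg_left k3 (by positivity)
    nlinarith [mul_nonneg hη.le hd0, mul_nonneg (mul_nonneg hη.le hd0) (sub_nonneg.2 hη1)]
  · rw [PiLp.smul_apply, smul_eq_mul, abs_mul, abs_of_nonneg (Real.sqrt_nonneg _)]
    calc Real.sqrt z₀ ≤ Real.sqrt p.1 * 1 := by rw [mul_one]; exact Real.sqrt_le_sqrt hz2
      _ ≤ _ := mul_le_mul_of_nonneg_left hw1 (Real.sqrt_nonneg _)

lemma map_neg_scaleMixture (Q : Measure ℝ) [IsProbabilityMeasure Q] (d : ℕ) :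
    (scaleMixture Q d).map (fun x => -x) = scaleMixture Q d := by
  have hm : Measurable (fun zw : ℝ × E d => Real.sqrt zw.1 • zw.2) := by fun_prop
  have hneg : (Q.prod (stdGaussian (E d))).map (Prod.map id (fun x => -x)) =
      Q.prod (stdGaussian (E d)) := by
    rw [← Measure.map_prod_map _ _ measurable_id (by fun_prop), Measure.map_id, map_neg_stdGaussian]
  rw [scaleMixture, Measure.map_map (by fun_prop) hm]
  conv_rhs => rw [← hneg]
  rw [Measure.map_map hm (by fun_prop)]
  congr 1
  funext p
  simp

lemma integral_scaleMixture_eq_zero_of_odd (Q : Measure ℝ) [IsProbabilityMeasure Q] {d : ℕ}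
    {g : E d → ℝ} (hg : ∀ x, g (-x) = -g x) : ∫ x, g x ∂(scaleMixture Q d) = 0 := by
  have hmp : MeasurePreserving (MeasurableEquiv.neg (E d)) (scaleMixture Q d) (scaleMixture Q d) :=
    ⟨(MeasurableEquiv.neg (E d)).measurable, map_neg_scaleMixture Q d⟩
  have h := hmp.integral_comp' g
  have h2 : ∫ x, g ((MeasurableEquiv.neg (E d)) x) ∂(scaleMixture Q d) =
      - ∫ x, g x ∂(scaleMixture Q d) := by
    rw [← integral_neg]
    exact integral_congr_ae (ae_of_all _ hg)
  linarith

/-- The test function `x ↦ arctan x₁`: bounded, odd, and strictly monotone. -/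
noncomputable def arctanTest : E 1 →ᵇ ℝ :=
  BoundedContinuousFunction.ofNormedAddCommGroup (fun x => Real.arctan (x 0))
    (Real.continuous_arctan.comp (by fun_prop)) (Real.pi / 2) fun x =>
      abs_le.2 ⟨(Real.neg_pi_div_two_lt_arctan _).le, (Real.arctan_lt_pi_div_two _).le⟩

/-- The index set of the first coordinate, empty if `d = 0`. -/
def firstIndex (d : ℕ) : Finset (Fin d) := Finset.univ.filter fun i => i.val = 0

lemma card_firstIndex {d : ℕ} (hd : 1 ≤ d) : (firstIndex d).card = 1 := by
  rw [Finset.card_eq_one]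
  refine ⟨⟨0, hd⟩, ?_⟩
  ext i
  simp [firstIndex, Fin.ext_iff]

lemma arctanTest_proj_firstIndex {d : ℕ} (hd : 1 ≤ d) (x : E d) :
    arctanTest (proj 1 (firstIndex d) x) = Real.arctan (x ⟨0, hd⟩) := by
  have hmem := (firstIndex d).orderEmbOfFin_mem (card_firstIndex hd) 0
  have h0 : (firstIndex d).orderEmbOfFin (card_firstIndex hd) 0 = ⟨0, hd⟩ :=
    Fin.ext (Finset.mem_filter.1 hmem).2
  change Real.arctan (proj 1 (firstIndex d) x 0) = _
  rw [proj, dif_pos (card_firstIndex hd)]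
  change Real.arctan (x ((firstIndex d).orderEmbOfFin (card_firstIndex hd) 0)) = _
  rw [h0]

/-- Off the Gaussian case the chain is still at its initial state after polynomially many steps, with
probability bounded below, so time averages keep the randomness of the initial state. -/
lemma not_averagesConverge_pow {ρ : ℝ} (hρ0 : 0 < ρ) (hρ1 : ρ < 1) {Q : Measure ℝ}
    [IsProbabilityMeasure Q] (hQ : Q (Set.Iic 0) = 0) (hne : Q ≠ Measure.dirac 1) (q : ℕ) :
    ¬ AveragesConverge (fun d => pCN ρ (scaleMixture Q d)) (scaleMixture Q) (fun d => d ^ q) := by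
  intro hconv
  obtain ⟨η, z₀, hη, hη1, hz₀, hZ⟩ := exists_measure_away_from_one_ne_zero hQ hne
  obtain ⟨b, hb, hlow⟩ := exists_scaleMixture_shell_lower_bound hQ hη hη1 hZ
  obtain ⟨c, hc0, hc1, hacc⟩ := exists_pow_bound_lintegral_accept hρ0.le hρ1 hη hη1
  have hε : 0 < Real.arctan (Real.sqrt z₀) := by
    rw [← Real.arctan_zero]
    exact Real.arctan_strictMono (Real.sqrt_pos.2 hz₀)
  have hT := hconv 1 arctanTest firstIndex (fun d hd => card_firstIndex hd) _ hε
  have hrej : Tendsto (fun d : ℕ => ((d ^ q : ℕ) : ℝ≥0∞) * ENNReal.ofReal (8 * c ^ d)) atTop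
      (𝓝 0) := by
    have h := (tendsto_pow_const_mul_const_pow_of_lt_one q hc0 hc1).const_mul 8
    rw [mul_zero] at h
    have h' := ENNReal.tendsto_ofReal h
    rw [ENNReal.ofReal_zero] at h'
    refine h'.congr fun d => ?_
    rw [← ENNReal.ofReal_natCast, ← ENNReal.ofReal_mul (Nat.cast_nonneg _)]
    congr 1
    push_cast
    ring
  have hsum := hT.add hrej
  rw [add_zero] at hsum
  refine hb (le_antisymm (ge_of_tendsto hsum ?_) zero_le)
  filter_upwards [hlow, eventually_ge_atTop 1] with d hd hd1
  have hB := measurableSet_shell η (Real.sqrt z₀) (⟨0, hd1⟩ : Fin d)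
  refine (hd ⟨0, hd1⟩).trans ((measure_le_pCN_stuck_add ρ (scaleMixture Q d) hB (d ^ q)).trans
    (add_le_add (measure_mono ?_) (mul_le_mul_right ?_ _)))
  · rintro x ⟨hx0, hstuck⟩
    have hmean : ∫ y, arctanTest (proj 1 (firstIndex d) y) ∂(scaleMixture Q d) = 0 :=
      integral_scaleMixture_eq_zero_of_odd Q fun y => by
        rw [arctanTest_proj_firstIndex hd1, arctanTest_proj_firstIndex hd1]
        exact Real.arctan_neg _
    have havg : (1 / ((d ^ q : ℕ) : ℝ)) *
        ∑ m ∈ Finset.range (d ^ q), arctanTest (proj 1 (firstIndex d) (x m)) =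
        Real.arctan (x 0 ⟨0, hd1⟩) := by
      rw [Finset.sum_congr rfl fun m hm => by rw [hstuck m (Finset.mem_range.1 hm)],
        Finset.sum_const, Finset.card_range, arctanTest_proj_firstIndex hd1, nsmul_eq_mul]
      have : ((d ^ q : ℕ) : ℝ) ≠ 0 := Nat.cast_ne_zero.2 (pow_ne_zero _ (by omega))
      field_simp
    change Real.arctan (Real.sqrt z₀) ≤ |_ - _|
    rw [hmean, havg, sub_zero]
    rcases le_abs.1 hx0.2 with h | h
    · exact (Real.arctan_mono h).trans (le_abs_self _)
    · refine (Real.arctan_mono h).trans ?_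
      rw [Real.arctan_neg]
      exact neg_le_abs _
  · refine le_trans (lintegral_mono_set fun x hx => hx.1)
      (hacc d hd1 (scaleMixture Q d) (scaleMixture_absolutelyContinuous hQ d))

lemma eq_dirac_of_hasPolynomialRate {ρ : ℝ} (hρ0 : 0 < ρ) (hρ1 : ρ < 1) {Q : Measure ℝ}
    [IsProbabilityMeasure Q] (hQ : Q (Set.Iic 0) = 0)
    (h : HasPolynomialRate (fun d => pCN ρ (scaleMixture Q d)) (scaleMixture Q)) :
    Q = Measure.dirac 1 := by
  obtain ⟨T, ⟨hT0, hT⟩, p, hp⟩ := h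
  by_contra hne
  refine not_averagesConverge_pow hρ0 hρ1 hQ hne (p + 1) (hT _ ?_ ?_)
  · exact tendsto_pow_atTop (Nat.succ_ne_zero p)
  · have hpos : Tendsto (fun d : ℕ => T d / (d : ℝ) ^ p) atTop (𝓝[>] 0) := by
      refine tendsto_nhdsWithin_iff.2 ⟨hp, ?_⟩
      filter_upwards [hT0, eventually_gt_atTop 0] with d hd hd0
      have : (0 : ℝ) < d := Nat.cast_pos.2 hd0
      exact div_pos hd (by positivity)
    refine (tendsto_natCast_atTop_atTop.atTop_mul_atTop₀ hpos.inv_tendsto_nhdsGT_zero).congr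
      fun d => ?_
    simp only [Pi.inv_apply, inv_div]
    push_cast
    ring

/-! ### The Gaussian autoregression as a skew product -/

/-- Prepending an independent variable to an i.i.d. sequence gives an i.i.d. sequence. -/
lemma infinitePi_map_cons {α : Type*} [MeasurableSpace α] (ν : Measure α) [IsProbabilityMeasure ν] :
    (ν.prod (Measure.infinitePi (fun _ : ℕ => ν))).map
      (fun p => fun n : ℕ => Nat.casesOn n p.1 p.2) = Measure.infinitePi (fun _ : ℕ => ν) := by
  have hm : Measurable (fun p : α × (ℕ → α) => (fun n => Nat.casesOn n p.1 p.2 : ℕ → α)) := by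
    refine measurable_pi_lambda _ fun n => ?_
    cases n with
    | zero => exact measurable_fst
    | succ n => exact (measurable_pi_apply n).comp measurable_snd
  refine Measure.eq_infinitePi _ fun s t ht => ?_
  -- Enlarge the index set to an initial segment, with full sets at the new indices.
  classical
  obtain ⟨N, hN⟩ : ∃ N, s ⊆ Finset.range (N + 1) := by
    refine ⟨s.sup id, fun i hi => Finset.mem_range.2 (Nat.lt_succ_of_le ?_)⟩
    exact Finset.le_sup (f := id) hi
  let t' : ℕ → Set α := fun i => if i ∈ s then t i else Set.univ
  have ht' : ∀ i, MeasurableSet (t' i) := fun i => by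
    by_cases hi : i ∈ s <;> simp [t', hi, ht i]
  have hprod : ∏ i ∈ s, ν (t i) = ∏ i ∈ Finset.range (N + 1), ν (t' i) := by
    rw [← Finset.prod_subset hN (f := fun i => ν (t' i)) fun i _ hi => by simp [t', hi]]
    exact Finset.prod_congr rfl fun i hi => by simp [t', hi]
  have hpre : (fun p : α × (ℕ → α) => (fun n => Nat.casesOn n p.1 p.2 : ℕ → α)) ⁻¹'
      ((s : Set ℕ).pi t) = t' 0 ×ˢ ((Finset.range N : Set ℕ).pi fun i => t' (i + 1)) := by
    ext p
    simp only [Set.mem_preimage, Set.mem_pi, Set.mem_prod, Finset.mem_coe, Finset.mem_range]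
    constructor
    · intro h
      refine ⟨?_, fun i _ => ?_⟩
      · by_cases h0 : 0 ∈ s
        · simpa [t', h0] using h 0 h0
        · simp [t', h0]
      · by_cases hi : i + 1 ∈ s
        · simpa [t', hi] using h (i + 1) hi
        · simp [t', hi]
    · rintro ⟨h0, h⟩ i hi
      cases i with
      | zero => simpa [t', hi] using h0
      | succ i =>
        have := h i (by have := Finset.mem_range.1 (hN hi); omega)
        simpa [t', hi] using this
  rw [Measure.map_apply hm (MeasurableSet.pi s.countable_toSet fun i _ => ht i), hpre,
    Measure.prod_prod, Measure.infinitePi_pi _ fun i _ => ht' (i + 1), hprod,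
    Finset.prod_range_succ', mul_comm]

lemma measurePreserving_head_tail {α : Type*} [MeasurableSpace α] (ν : Measure α)
    [IsProbabilityMeasure ν] :
    MeasurePreserving (fun ω : ℕ → α => (ω 0, fun n => ω (n + 1)))
      (Measure.infinitePi (fun _ : ℕ => ν)) (ν.prod (Measure.infinitePi (fun _ : ℕ => ν))) := by
  have hm : Measurable (fun ω : ℕ → α => (ω 0, fun n => ω (n + 1))) := by fun_prop
  have hc : Measurable (fun p : α × (ℕ → α) => (fun n => Nat.casesOn n p.1 p.2 : ℕ → α)) := by
    refine measurable_pi_lambda _ fun n => ?_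
    cases n with
    | zero => exact measurable_fst
    | succ n => exact (measurable_pi_apply n).comp measurable_snd
  refine ⟨hm, ?_⟩
  conv_lhs => rw [← infinitePi_map_cons ν]
  rw [Measure.map_map hm hc]
  exact Measure.map_id

/-- The law of the driving sequence of the chain. -/
noncomputable abbrev drivingLaw (d : ℕ) : Measure (ℕ → E d × unitInterval) :=
  Measure.infinitePi (fun _ : ℕ => (stdGaussian (E d)).prod (volume : Measure unitInterval))

/-- The Gaussian autoregression: the chain that accepts each proposal. -/
noncomputable def autoreg {d : ℕ} (ρ : ℝ) (x : E d) (ω : ℕ → E d × unitInterval) : ℕ → E d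
  | 0 => x
  | m + 1 => proposal ρ (autoreg ρ x ω m) (ω m).1

/-- One step of the autoregression together with a shift of the driving sequence. -/
noncomputable def skewShift {d : ℕ} (ρ : ℝ) (p : E d × (ℕ → E d × unitInterval)) :
    E d × (ℕ → E d × unitInterval) :=
  (proposal ρ p.1 (p.2 0).1, fun n => p.2 (n + 1))

lemma skewShift_iterate {d : ℕ} (ρ : ℝ) (p : E d × (ℕ → E d × unitInterval)) (m : ℕ) :
    (skewShift ρ)^[m] p = (autoreg ρ p.1 p.2 m, fun n => p.2 (n + m)) := by
  induction m with
  | zero => rfl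
  | succ m ih =>
    rw [Function.iterate_succ_apply', ih, skewShift]
    simp only [autoreg, Nat.zero_add, Prod.mk.injEq, true_and]
    funext n
    rw [Nat.add_right_comm, Nat.add_assoc]

lemma autoreg_add {d : ℕ} (ρ : ℝ) (p : E d × (ℕ → E d × unitInterval)) (m n : ℕ) :
    autoreg ρ p.1 p.2 (m + n) =
      autoreg ρ ((skewShift ρ)^[m] p).1 ((skewShift ρ)^[m] p).2 n := by
  have h := Function.iterate_add_apply (skewShift ρ) n m p
  rw [skewShift_iterate ρ ((skewShift ρ)^[m] p) n, skewShift_iterate ρ p (n + m), Nat.add_comm] at h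
  exact congrArg Prod.fst h

lemma map_proposal_stdGaussian (d : ℕ) {ρ : ℝ} (hρ0 : 0 ≤ ρ) (hρ1 : ρ ≤ 1) :
    ((stdGaussian (E d)).prod (stdGaussian (E d))).map (fun p => proposal ρ p.1 p.2) =
      stdGaussian (E d) := by
  have h := map_smul_add_smul_stdGaussian d (Real.sqrt ρ) (Real.sqrt (1 - ρ)) 1
    (by rw [Real.sq_sqrt hρ0, Real.sq_sqrt (by linarith)]; ring)
  simpa [proposal] using h

lemma measurePreserving_skewShift (d : ℕ) {ρ : ℝ} (hρ0 : 0 ≤ ρ) (hρ1 : ρ ≤ 1) :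
    MeasurePreserving (skewShift ρ) ((stdGaussian (E d)).prod (drivingLaw d))
      ((stdGaussian (E d)).prod (drivingLaw d)) := by
  have hprop := measurable_proposal (d := d) ρ
  have h1 := (MeasurePreserving.id (stdGaussian (E d))).prod (measurePreserving_head_tail
    ((stdGaussian (E d)).prod (volume : Measure unitInterval)))
  have h2 := (measurePreserving_prodAssoc (stdGaussian (E d))
    ((stdGaussian (E d)).prod (volume : Measure unitInterval)) (drivingLaw d)).symm
  have h3 : MeasurePreserving (fun q : E d × (E d × unitInterval) => proposal ρ q.1 q.2.1)
      ((stdGaussian (E d)).prod ((stdGaussian (E d)).prod (volume : Measure unitInterval)))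
      (stdGaussian (E d)) := by
    have ha : MeasurePreserving (fun p : E d × E d => proposal ρ p.1 p.2)
        ((stdGaussian (E d)).prod (stdGaussian (E d))) (stdGaussian (E d)) :=
      ⟨hprop, map_proposal_stdGaussian d hρ0 hρ1⟩
    exact ha.comp ((MeasurePreserving.id (stdGaussian (E d))).prod
      (measurePreserving_fst (μ := stdGaussian (E d)) (ν := (volume : Measure unitInterval))))
  exact (h3.prod (MeasurePreserving.id (drivingLaw d))).comp (h2.comp h1)

lemma measurable_autoreg {d : ℕ} (ρ : ℝ) (m : ℕ) :
    Measurable (fun p : E d × (ℕ → E d × unitInterval) => autoreg ρ p.1 p.2 m) := by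
  have hprop := measurable_proposal (d := d) ρ
  induction m with
  | zero => exact measurable_fst
  | succ m ih =>
    have hm : Measurable (fun p : E d × (ℕ → E d × unitInterval) => (p.2 m).1) :=
      measurable_fst.comp ((measurable_pi_apply m).comp measurable_snd)
    exact hprop.comp (ih.prodMk hm)

/-- For the Gaussian target both densities cancel: almost all proposals are accepted. The exceptional
null set comes from the Radon-Nikodym derivative being determined only almost everywhere. -/
lemma accept_stdGaussian_ae (d : ℕ) {ρ : ℝ} (hρ0 : 0 ≤ ρ) (hρ1 : ρ ≤ 1) :
    ∀ᵐ p ∂((stdGaussian (E d)).prod (stdGaussian (E d))),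
      accept (stdGaussian (E d)) p.1 (proposal ρ p.1 p.2) = 1 := by
  have hprop := measurable_proposal (d := d) ρ
  have hd : ∀ᵐ x ∂(stdGaussian (E d)),
      (stdGaussian (E d)).rnDeriv volume x = stdNormalDensity d x := by
    refine (stdGaussian_absolutelyContinuous d).ae_le ?_
    have h := Measure.rnDeriv_withDensity (volume : Measure (E d)) (measurable_stdNormalDensity d)
    rw [← stdGaussian_eq_withDensity] at h
    exact h
  have h1 := (Measure.quasiMeasurePreserving_fst (μ := stdGaussian (E d))
    (ν := stdGaussian (E d))).ae hd
  have h2 := (MeasurePreserving.quasiMeasurePreserving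
    ⟨hprop, map_proposal_stdGaussian d hρ0 hρ1⟩).ae hd
  filter_upwards [h1, h2] with p hp1 hp2
  rw [accept, hp1, hp2, mul_comm, ENNReal.div_self, min_self]
  · exact mul_ne_zero (stdNormalDensity_ne_zero d _) (stdNormalDensity_ne_zero d _)
  · exact ENNReal.mul_ne_top (stdNormalDensity_ne_top d _) (stdNormalDensity_ne_top d _)

lemma chain_eq_autoreg_ae (d : ℕ) {ρ : ℝ} (hρ0 : 0 ≤ ρ) (hρ1 : ρ ≤ 1) :
    ∀ᵐ p ∂((stdGaussian (E d)).prod (drivingLaw d)),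
      ∀ m, chain ρ (stdGaussian (E d)) p.1 p.2 m = autoreg ρ p.1 p.2 m := by
  have h0 : ∀ᵐ p ∂((stdGaussian (E d)).prod (drivingLaw d)),
      accept (stdGaussian (E d)) p.1 (proposal ρ p.1 (p.2 0).1) = 1 := by
    have hmp : MeasurePreserving (fun p : E d × (ℕ → E d × unitInterval) => (p.1, (p.2 0).1))
        ((stdGaussian (E d)).prod (drivingLaw d)) ((stdGaussian (E d)).prod (stdGaussian (E d))) :=
      (MeasurePreserving.id (stdGaussian (E d))).prod
        (measurePreserving_fst.comp (measurePreserving_eval_infinitePi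
          (fun _ : ℕ => (stdGaussian (E d)).prod (volume : Measure unitInterval)) 0))
    exact hmp.quasiMeasurePreserving.ae (accept_stdGaussian_ae d hρ0 hρ1)
  have hall := ae_all_iff.2 fun m =>
    ((measurePreserving_skewShift d hρ0 hρ1).iterate m).quasiMeasurePreserving.ae h0
  filter_upwards [hall] with p hp m
  induction m with
  | zero => rfl
  | succ m ih =>
    have hm := hp m
    simp only [skewShift_iterate, Nat.zero_add] at hm
    rw [chain, ih, step, hm, if_pos]
    · rfl
    · exact ENNReal.ofReal_le_one.2 (p.2 m).2.2.2

/-- The `m`-step transition law of the autoregression. -/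
lemma map_autoreg (d : ℕ) {ρ : ℝ} (hρ0 : 0 ≤ ρ) (hρ1 : ρ ≤ 1) (m : ℕ) (x : E d) :
    (drivingLaw d).map (fun ω => autoreg ρ x ω m) =
      (stdGaussian (E d)).map
        (fun w => Real.sqrt ρ ^ m • x + Real.sqrt (1 - ρ ^ m) • w) := by
  induction m generalizing x with
  | zero => simp [autoreg]
  | succ m ih =>
    have hprop := measurable_proposal (d := d) ρ
    have hpow1 : ρ ^ m ≤ 1 := pow_le_one₀ hρ0 hρ1
    have hpow2 : ρ ^ (m + 1) ≤ 1 := pow_le_one₀ hρ0 hρ1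
    ext s hs
    have hG : Measurable (fun q : (E d × unitInterval) × (ℕ → E d × unitInterval) =>
        autoreg ρ (proposal ρ x q.1.1) q.2 m) :=
      (measurable_autoreg ρ m).comp ((hprop.comp (measurable_const.prodMk
        (measurable_fst.comp measurable_fst))).prodMk measurable_snd)
    have hA : Measurable (fun ω : ℕ → E d × unitInterval => autoreg ρ x ω (m + 1)) :=
      (measurable_autoreg ρ (m + 1)).comp measurable_prodMk_left
    have hK : Measurable (fun q : E d × E d =>
        Real.sqrt ρ ^ m • proposal ρ x q.1 + Real.sqrt (1 - ρ ^ m) • q.2) := by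
      unfold proposal
      fun_prop
    have hshift : ∀ ω : ℕ → E d × unitInterval, autoreg ρ x ω (m + 1) =
        autoreg ρ (proposal ρ x (ω 0).1) (fun n => ω (n + 1)) m := fun ω => by
      rw [Nat.add_comm]
      exact autoreg_add ρ (x, ω) 1 m
    have hsum := map_smul_add_smul_stdGaussian d (Real.sqrt ρ ^ m * Real.sqrt (1 - ρ))
      (Real.sqrt (1 - ρ ^ m)) (Real.sqrt (1 - ρ ^ (m + 1))) (by
        rw [mul_pow, ← pow_mul, mul_comm m 2, pow_mul, Real.sq_sqrt hρ0,
          Real.sq_sqrt (by linarith), Real.sq_sqrt (by linarith), Real.sq_sqrt (by linarith)]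
        ring)
    calc (drivingLaw d).map (fun ω => autoreg ρ x ω (m + 1)) s
        = (((stdGaussian (E d)).prod (volume : Measure unitInterval)).prod (drivingLaw d))
            ((fun q => autoreg ρ (proposal ρ x q.1.1) q.2 m) ⁻¹' s) := by
          rw [Measure.map_apply hA hs, ← (measurePreserving_head_tail
            ((stdGaussian (E d)).prod (volume : Measure unitInterval))).measure_preimage
            (hG hs).nullMeasurableSet]
          congr 1
          ext ω
          simp only [Set.mem_preimage, hshift]
      _ = ∫⁻ v, (stdGaussian (E d)) {w | Real.sqrt ρ ^ m • proposal ρ x v.1 +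
            Real.sqrt (1 - ρ ^ m) • w ∈ s}
            ∂((stdGaussian (E d)).prod (volume : Measure unitInterval)) := by
          rw [Measure.prod_apply (hG hs)]
          refine lintegral_congr fun v => ?_
          have h := congrArg (fun μ : Measure (E d) => μ s) (ih (proposal ρ x v.1))
          simp only at h
          have hAm : Measurable (fun ω : ℕ → E d × unitInterval =>
              autoreg ρ (proposal ρ x v.1) ω m) :=
            (measurable_autoreg ρ m).comp measurable_prodMk_left
          rw [Measure.map_apply hAm hs, Measure.map_apply (by fun_prop) hs] at h
          exact h
      _ = ∫⁻ v, (stdGaussian (E d)) {w | Real.sqrt ρ ^ m • proposal ρ x v +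
            Real.sqrt (1 - ρ ^ m) • w ∈ s} ∂(stdGaussian (E d)) :=
          (measurePreserving_fst (μ := stdGaussian (E d))
            (ν := (volume : Measure unitInterval))).lintegral_comp
            (measurable_measure_prodMk_left (hK hs))
      _ = ((stdGaussian (E d)).prod (stdGaussian (E d)))
            ((fun q => Real.sqrt ρ ^ m • proposal ρ x q.1 + Real.sqrt (1 - ρ ^ m) • q.2) ⁻¹' s) :=
          (Measure.prod_apply (hK hs)).symm
      _ = (stdGaussian (E d)).map
            (fun w => Real.sqrt ρ ^ (m + 1) • x + Real.sqrt (1 - ρ ^ (m + 1)) • w) s := by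
          have hadd : Measurable (fun u : E d => Real.sqrt ρ ^ (m + 1) • x + u) := by fun_prop
          rw [show (fun w : E d => Real.sqrt ρ ^ (m + 1) • x + Real.sqrt (1 - ρ ^ (m + 1)) • w) =
              (fun u => Real.sqrt ρ ^ (m + 1) • x + u) ∘
                (fun w => Real.sqrt (1 - ρ ^ (m + 1)) • w) from rfl,
            ← Measure.map_map hadd (by fun_prop), ← hsum, Measure.map_map hadd (by fun_prop),
            Measure.map_apply (by fun_prop) hs]
          congr 1
          ext q
          simp only [Set.mem_preimage, Function.comp_apply, proposal]
          have : Real.sqrt ρ ^ m • (Real.sqrt ρ • x + Real.sqrt (1 - ρ) • q.1) +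
              Real.sqrt (1 - ρ ^ m) • q.2 = Real.sqrt ρ ^ (m + 1) • x +
              ((Real.sqrt ρ ^ m * Real.sqrt (1 - ρ)) • q.1 + Real.sqrt (1 - ρ ^ m) • q.2) := by
            rw [pow_succ]
            module
          rw [this]

/-! ### Decorrelation and consistency for the Gaussian target -/

lemma measurable_proj {d : ℕ} (k : ℕ) (S : Finset (Fin d)) : Measurable (proj k S) := by
  unfold proj
  split_ifs <;> fun_prop

lemma proj_smul_add_smul {d k : ℕ} {S : Finset (Fin d)} (hS : S.card = k) (a b : ℝ) (x y : E d) :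
    proj k S (a • x + b • y) = a • proj k S x + b • proj k S y := by
  simp only [proj, dif_pos hS]
  ext j
  simp

/-- Any `k` coordinates of a standard Gaussian vector form a standard Gaussian vector. -/
lemma map_proj_stdGaussian {d k : ℕ} {S : Finset (Fin d)} (hS : S.card = k) :
    (stdGaussian (E d)).map (proj k S) = stdGaussian (E k) := by
  have hm := measurable_proj k S
  have : IsProbabilityMeasure ((stdGaussian (E d)).map (proj k S)) :=
    Measure.isProbabilityMeasure_map hm.aemeasurable
  refine Measure.ext_of_charFun ?_
  ext t
  -- The adjoint of the projection embeds `ℝ^k` isometrically.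
  let t' : E d := ∑ j, t j • EuclideanSpace.single (S.orderEmbOfFin hS j) (1 : ℝ)
  have hinner : ∀ x : E d, inner ℝ x t' = inner ℝ (proj k S x) t := by
    intro x
    simp only [t', inner_sum, proj, dif_pos hS, PiLp.inner_apply]
    simp
  have hproj : proj k S t' = t := by
    simp only [proj, dif_pos hS]
    ext j
    simp [t', Pi.single_apply]
  have hnorm : ‖t'‖ ^ 2 = ‖t‖ ^ 2 := by
    rw [← real_inner_self_eq_norm_sq, hinner, hproj, real_inner_self_eq_norm_sq]
  calc charFun ((stdGaussian (E d)).map (proj k S)) t = charFun (stdGaussian (E d)) t' := by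
        rw [charFun_apply, charFun_apply, integral_map hm.aemeasurable (by fun_prop)]
        simp_rw [hinner]
    _ = charFun (stdGaussian (E k)) t := by
        rw [charFun_stdGaussian, charFun_stdGaussian, ← Complex.ofReal_pow, hnorm,
          Complex.ofReal_pow]

/-- The covariance of `f` at lag `m` along the stationary `k`-dimensional autoregression, for `f` of
Gaussian mean zero. -/
noncomputable def autocov {k : ℕ} (ρ : ℝ) (f : E k →ᵇ ℝ) (m : ℕ) : ℝ :=
  ∫ p, f p.1 * f (Real.sqrt ρ ^ m • p.1 + Real.sqrt (1 - ρ ^ m) • p.2)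
    ∂((stdGaussian (E k)).prod (stdGaussian (E k)))

lemma tendsto_autocov {k : ℕ} {ρ : ℝ} (hρ0 : 0 ≤ ρ) (hρ1 : ρ < 1) (f : E k →ᵇ ℝ) :
    Tendsto (autocov ρ f) atTop (𝓝 ((∫ x, f x ∂(stdGaussian (E k))) ^ 2)) := by
  have hlim : (∫ x, f x ∂(stdGaussian (E k))) ^ 2 =
      ∫ p, f p.1 * f p.2 ∂((stdGaussian (E k)).prod (stdGaussian (E k))) := by
    rw [integral_prod_mul (fun x => f x) (fun x => f x), sq]
  rw [hlim]
  refine tendsto_integral_of_dominated_convergence (fun _ => ‖f‖ * ‖f‖) (fun m => ?_)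
    (integrable_const _) (fun m => ae_of_all _ fun p => ?_) (ae_of_all _ fun p => ?_)
  · exact Measurable.aestronglyMeasurable ((f.continuous.measurable.comp measurable_fst).mul
      (f.continuous.measurable.comp (by fun_prop)))
  · rw [norm_mul]
    exact mul_le_mul (f.norm_coe_le_norm _) (f.norm_coe_le_norm _) (norm_nonneg _) (norm_nonneg _)
  · have ha : Tendsto (fun m => Real.sqrt ρ ^ m) atTop (𝓝 0) :=
      tendsto_pow_atTop_nhds_zero_of_lt_one (Real.sqrt_nonneg _)
        ((Real.sqrt_lt' one_pos).2 (by simpa using hρ1))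
    have hb : Tendsto (fun m => Real.sqrt (1 - ρ ^ m)) atTop (𝓝 1) := by
      have h := (tendsto_pow_atTop_nhds_zero_of_lt_one hρ0 hρ1).const_sub 1
      rw [sub_zero] at h
      simpa using h.sqrt
    have hv := (ha.smul_const p.1).add (hb.smul_const p.2)
    rw [zero_smul, one_smul, zero_add] at hv
    exact ((f.continuous.tendsto p.2).comp hv).const_mul (f p.1)

/-- The covariance at lag `n` of a function of `k` coordinates does not depend on the ambient
dimension. -/
lemma integral_mul_autoreg {d k : ℕ} {ρ : ℝ} (hρ0 : 0 ≤ ρ) (hρ1 : ρ ≤ 1) {S : Finset (Fin d)}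
    (hS : S.card = k) (f : E k →ᵇ ℝ) (n : ℕ) :
    ∫ p, f (proj k S p.1) * f (proj k S (autoreg ρ p.1 p.2 n))
      ∂((stdGaussian (E d)).prod (drivingLaw d)) = autocov ρ f n := by
  have hπ := measurable_proj k S
  have hf := f.continuous.measurable
  have hg : Measurable (fun x : E d => f (proj k S x)) := hf.comp hπ
  have hbound : ∀ u v : E k, ‖f u * f v‖ ≤ ‖f‖ * ‖f‖ := fun u v => by
    rw [norm_mul]
    exact mul_le_mul (f.norm_coe_le_norm _) (f.norm_coe_le_norm _) (norm_nonneg _) (norm_nonneg _)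
  have hm1 : Measurable (fun p : E d × (ℕ → E d × unitInterval) =>
      f (proj k S p.1) * f (proj k S (autoreg ρ p.1 p.2 n))) :=
    (hg.comp measurable_fst).mul (hg.comp (measurable_autoreg ρ n))
  have hm2 : Measurable (fun p : E d × E d => f (proj k S p.1) *
      f (proj k S (Real.sqrt ρ ^ n • p.1 + Real.sqrt (1 - ρ ^ n) • p.2))) :=
    (hg.comp measurable_fst).mul (hg.comp (by fun_prop))
  have hm3 : Measurable (fun p : E k × E k => f p.1 *
      f (Real.sqrt ρ ^ n • p.1 + Real.sqrt (1 - ρ ^ n) • p.2)) :=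
    (hf.comp measurable_fst).mul (hf.comp (by fun_prop))
  have hmap : ((stdGaussian (E d)).prod (stdGaussian (E d))).map
      (Prod.map (proj k S) (proj k S)) = (stdGaussian (E k)).prod (stdGaussian (E k)) := by
    rw [← Measure.map_prod_map _ _ hπ hπ, map_proj_stdGaussian hS]
  calc ∫ p, f (proj k S p.1) * f (proj k S (autoreg ρ p.1 p.2 n))
      ∂((stdGaussian (E d)).prod (drivingLaw d))
      = ∫ x, ∫ ω, f (proj k S x) * f (proj k S (autoreg ρ x ω n)) ∂(drivingLaw d)
          ∂(stdGaussian (E d)) :=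
        integral_prod _ (Integrable.of_bound hm1.aestronglyMeasurable _
          (ae_of_all _ fun p => hbound _ _))
    _ = ∫ x, ∫ w, f (proj k S x) *
          f (proj k S (Real.sqrt ρ ^ n • x + Real.sqrt (1 - ρ ^ n) • w)) ∂(stdGaussian (E d))
          ∂(stdGaussian (E d)) := by
        refine integral_congr_ae (ae_of_all _ fun x => ?_)
        have hy : Measurable (fun y : E d => f (proj k S x) * f (proj k S y)) := hg.const_mul _
        have hA : Measurable (fun ω : ℕ → E d × unitInterval => autoreg ρ x ω n) :=
          (measurable_autoreg ρ n).comp measurable_prodMk_left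
        have h := congrArg (fun μ : Measure (E d) => ∫ y, f (proj k S x) * f (proj k S y) ∂μ)
          (map_autoreg d hρ0 hρ1 n x)
        simp only at h
        rwa [integral_map hA.aemeasurable hy.aestronglyMeasurable,
          integral_map (by fun_prop) hy.aestronglyMeasurable] at h
    _ = ∫ p, f (proj k S p.1) *
          f (proj k S (Real.sqrt ρ ^ n • p.1 + Real.sqrt (1 - ρ ^ n) • p.2))
          ∂((stdGaussian (E d)).prod (stdGaussian (E d))) :=
        (integral_prod _ (Integrable.of_bound hm2.aestronglyMeasurable _
          (ae_of_all _ fun p => hbound _ _))).symm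
    _ = autocov ρ f n := by
        rw [autocov, ← hmap, integral_map (hπ.prodMap hπ).aemeasurable hm3.aestronglyMeasurable]
        simp only [proj_smul_add_smul hS, Prod.map_fst, Prod.map_snd]

lemma integral_autoreg_mul_autoreg {d k : ℕ} {ρ : ℝ} (hρ0 : 0 ≤ ρ) (hρ1 : ρ ≤ 1)
    {S : Finset (Fin d)} (hS : S.card = k) (f : E k →ᵇ ℝ) (i n : ℕ) :
    ∫ p, f (proj k S (autoreg ρ p.1 p.2 i)) * f (proj k S (autoreg ρ p.1 p.2 (i + n)))
      ∂((stdGaussian (E d)).prod (drivingLaw d)) = autocov ρ f n := by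
  have hmp := (measurePreserving_skewShift d hρ0 hρ1).iterate i
  have hg : Measurable (fun x : E d => f (proj k S x)) :=
    f.continuous.measurable.comp (measurable_proj k S)
  have hm1 : Measurable (fun p : E d × (ℕ → E d × unitInterval) =>
      f (proj k S p.1) * f (proj k S (autoreg ρ p.1 p.2 n))) :=
    (hg.comp measurable_fst).mul (hg.comp (measurable_autoreg ρ n))
  rw [← integral_mul_autoreg hρ0 hρ1 hS f n, ← hmp.map_eq,
    integral_map hmp.measurable.aemeasurable hm1.aestronglyMeasurable, hmp.map_eq]
  refine integral_congr_ae (ae_of_all _ fun p => ?_)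
  simp only [autoreg_add ρ p i n, skewShift_iterate]

/-- In a double sum over a square, each lag occurs at most twice in each row. -/
lemma sum_sum_le_of_lag_bound (a : ℕ → ℕ → ℝ) (e : ℕ → ℝ) (he : ∀ n, 0 ≤ e n)
    (h1 : ∀ i n, a i (i + n) ≤ e n) (h2 : ∀ i n, a (i + n) i ≤ e n) (M : ℕ) :
    ∑ i ∈ Finset.range M, ∑ j ∈ Finset.range M, a i j ≤
      M * (2 * ∑ n ∈ Finset.range M, e n) := by
  have hrow : ∀ i ∈ Finset.range M, ∑ j ∈ Finset.range M, a i j ≤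
      2 * ∑ n ∈ Finset.range M, e n := by
    intro i hi
    rw [Finset.mem_range] at hi
    rw [← Finset.sum_filter_add_sum_filter_not (Finset.range M) (fun j => i ≤ j), two_mul]
    refine add_le_add ?_ ?_
    · calc ∑ j ∈ Finset.range M with i ≤ j, a i j
          ≤ ∑ j ∈ Finset.range M with i ≤ j, e (j - i) := by
            refine Finset.sum_le_sum fun j hj => ?_
            have h := h1 i (j - i)
            rwa [Nat.add_sub_cancel' (Finset.mem_filter.1 hj).2] at h
        _ = ∑ n ∈ ((Finset.range M).filter (i ≤ ·)).image (· - i), e n := by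
            rw [Finset.sum_image]
            intro x hx y hy hxy
            simp only [Finset.coe_filter, Finset.mem_range, Set.mem_ofPred_eq] at hx hy hxy
            omega
        _ ≤ ∑ n ∈ Finset.range M, e n := by
            refine Finset.sum_le_sum_of_subset_of_nonneg ?_ fun n _ _ => he n
            intro n hn
            obtain ⟨j, hj, rfl⟩ := Finset.mem_image.1 hn
            simp only [Finset.mem_filter, Finset.mem_range] at hj ⊢
            omega
    · calc ∑ j ∈ Finset.range M with ¬ i ≤ j, a i j
          ≤ ∑ j ∈ Finset.range M with ¬ i ≤ j, e (i - j) := by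
            refine Finset.sum_le_sum fun j hj => ?_
            have h := h2 j (i - j)
            rwa [Nat.add_sub_cancel' (not_le.1 (Finset.mem_filter.1 hj).2).le] at h
        _ = ∑ n ∈ ((Finset.range M).filter (¬ i ≤ ·)).image (i - ·), e n := by
            rw [Finset.sum_image]
            intro x hx y hy hxy
            simp only [Finset.coe_filter, Finset.mem_range, Set.mem_ofPred_eq] at hx hy hxy
            omega
        _ ≤ ∑ n ∈ Finset.range M, e n := by
            refine Finset.sum_le_sum_of_subset_of_nonneg ?_ fun n _ _ => he n
            intro n hn
            obtain ⟨j, hj, rfl⟩ := Finset.mem_image.1 hn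
            simp only [Finset.mem_filter, Finset.mem_range] at hj ⊢
            omega
  refine (Finset.sum_le_sum hrow).trans (le_of_eq ?_)
  simp

lemma integral_sum_autoreg_sq_le {d k : ℕ} {ρ : ℝ} (hρ0 : 0 ≤ ρ) (hρ1 : ρ ≤ 1)
    {S : Finset (Fin d)} (hS : S.card = k) (f : E k →ᵇ ℝ) (M : ℕ) :
    ∫ p, (∑ i ∈ Finset.range M, f (proj k S (autoreg ρ p.1 p.2 i))) ^ 2
      ∂((stdGaussian (E d)).prod (drivingLaw d)) ≤
      M * (2 * ∑ n ∈ Finset.range M, |autocov ρ f n|) := by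
  have hg : Measurable (fun x : E d => f (proj k S x)) :=
    f.continuous.measurable.comp (measurable_proj k S)
  have hint : ∀ i j : ℕ, Integrable (fun p : E d × (ℕ → E d × unitInterval) =>
      f (proj k S (autoreg ρ p.1 p.2 i)) * f (proj k S (autoreg ρ p.1 p.2 j)))
      ((stdGaussian (E d)).prod (drivingLaw d)) := fun i j =>
    Integrable.of_bound ((hg.comp (measurable_autoreg ρ i)).mul
      (hg.comp (measurable_autoreg ρ j))).aestronglyMeasurable (‖f‖ * ‖f‖)
      (ae_of_all _ fun p => by
        rw [norm_mul]
        exact mul_le_mul (f.norm_coe_le_norm _) (f.norm_coe_le_norm _) (norm_nonneg _)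
          (norm_nonneg _))
  simp_rw [sq, Finset.sum_mul_sum]
  rw [integral_finsetSum _ fun i _ => integrable_finsetSum _ fun j _ => hint i j]
  rw [Finset.sum_congr rfl fun i _ => integral_finsetSum _ fun j _ => hint i j]
  refine sum_sum_le_of_lag_bound (fun i j => ∫ p, f (proj k S (autoreg ρ p.1 p.2 i)) *
    f (proj k S (autoreg ρ p.1 p.2 j)) ∂((stdGaussian (E d)).prod (drivingLaw d))) _
    (fun n => abs_nonneg _) (fun i n => ?_) (fun i n => ?_) M
  · simp only [integral_autoreg_mul_autoreg hρ0 hρ1 hS f i n]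
    exact le_abs_self _
  · simp only [mul_comm (f (proj k S (autoreg ρ _ _ (i + n)))),
      integral_autoreg_mul_autoreg hρ0 hρ1 hS f i n]
    exact le_abs_self _

lemma measure_autoreg_average_ge_le {d k : ℕ} {ρ : ℝ} (hρ0 : 0 ≤ ρ) (hρ1 : ρ ≤ 1)
    {S : Finset (Fin d)} (hS : S.card = k) (f : E k →ᵇ ℝ) {M : ℕ} (hM : 0 < M) {ε : ℝ}
    (hε : 0 < ε) :
    ((stdGaussian (E d)).prod (drivingLaw d))
      {p | ε ≤ |(1 / (M : ℝ)) * ∑ i ∈ Finset.range M, f (proj k S (autoreg ρ p.1 p.2 i))|} ≤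
      ENNReal.ofReal (2 / ε ^ 2 * ((M : ℝ)⁻¹ * ∑ n ∈ Finset.range M, |autocov ρ f n|)) := by
  have hM' : (0 : ℝ) < M := Nat.cast_pos.2 hM
  have hg : Measurable (fun x : E d => f (proj k S x)) :=
    f.continuous.measurable.comp (measurable_proj k S)
  have hsum : Measurable (fun p : E d × (ℕ → E d × unitInterval) =>
      ∑ i ∈ Finset.range M, f (proj k S (autoreg ρ p.1 p.2 i))) :=
    Finset.measurable_fun_sum _ fun i _ => hg.comp (measurable_autoreg ρ i)
  have hint : Integrable (fun p : E d × (ℕ → E d × unitInterval) =>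
      (∑ i ∈ Finset.range M, f (proj k S (autoreg ρ p.1 p.2 i))) ^ 2)
      ((stdGaussian (E d)).prod (drivingLaw d)) := by
    refine Integrable.of_bound (hsum.pow_const 2).aestronglyMeasurable ((M * ‖f‖) ^ 2)
      (ae_of_all _ fun p => ?_)
    rw [norm_pow]
    refine pow_le_pow_left₀ (norm_nonneg _) ((norm_sum_le _ _).trans
      ((Finset.sum_le_sum fun i _ => f.norm_coe_le_norm _).trans (le_of_eq ?_))) 2
    simp
  have hmarkov := mul_meas_ge_le_integral_of_nonneg (ae_of_all _ fun p => sq_nonneg _) hint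
    ((M * ε) ^ 2)
  have hset : {p : E d × (ℕ → E d × unitInterval) |
      ε ≤ |(1 / (M : ℝ)) * ∑ i ∈ Finset.range M, f (proj k S (autoreg ρ p.1 p.2 i))|} ⊆
      {p | (M * ε) ^ 2 ≤ (∑ i ∈ Finset.range M, f (proj k S (autoreg ρ p.1 p.2 i))) ^ 2} := by
    intro p hp
    rw [Set.mem_ofPred_eq, abs_mul, abs_of_pos (by positivity : 0 < 1 / (M : ℝ)), one_div,
      inv_mul_eq_div, le_div_iff₀ hM'] at hp
    rw [Set.mem_ofPred_eq, ← sq_abs (∑ i ∈ Finset.range M, _)]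
    exact pow_le_pow_left₀ (by positivity) (by linarith) 2
  rw [← ofReal_measureReal]
  refine ENNReal.ofReal_le_ofReal ((measureReal_mono hset).trans ?_)
  have hle := hmarkov.trans (integral_sum_autoreg_sq_le hρ0 hρ1 hS f M)
  rw [← le_div_iff₀' (by positivity)] at hle
  refine hle.trans (le_of_eq ?_)
  field_simp

lemma scaleMixture_dirac_one (d : ℕ) : scaleMixture (Measure.dirac 1) d = stdGaussian (E d) := by
  rw [scaleMixture, Measure.dirac_prod, Measure.map_map (by fun_prop) (by fun_prop)]
  have : ((fun zw : ℝ × E d => Real.sqrt zw.1 • zw.2) ∘ Prod.mk 1) = id := by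
    funext x
    simp
  rw [this, Measure.map_id]

lemma consistent_stdGaussian {ρ : ℝ} (hρ0 : 0 ≤ ρ) (hρ1 : ρ < 1) :
    Consistent (fun d => pCN ρ (stdGaussian (E d))) (fun d => stdGaussian (E d)) := by
  intro M hM k f S hS ε hε
  let c : ℝ := ∫ x, f x ∂(stdGaussian (E k))
  let f₀ : E k →ᵇ ℝ := f - BoundedContinuousFunction.const (E k) c
  have hf₀ : ∫ x, f₀ x ∂(stdGaussian (E k)) = 0 := by
    have h : ∫ x, (f x - c) ∂(stdGaussian (E k)) = 0 := by
      rw [integral_sub (f.integrable _) (integrable_const c)]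
      simp [c]
    exact h
  have hcov : Tendsto (fun n => |autocov ρ f₀ n|) atTop (𝓝 0) := by
    have h := (tendsto_autocov hρ0 hρ1 f₀).abs
    simpa [hf₀] using h
  have hces := ((hcov.cesaro.comp hM).const_mul (2 / ε ^ 2))
  rw [mul_zero] at hces
  have hlim := ENNReal.tendsto_ofReal hces
  rw [ENNReal.ofReal_zero] at hlim
  refine tendsto_of_tendsto_of_tendsto_of_le_of_le' tendsto_const_nhds hlim
    (Eventually.of_forall fun _ => zero_le) ?_
  filter_upwards [eventually_ge_atTop k, hM.eventually_gt_atTop 0] with d hd hMd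
  have hSd := hS d hd
  have hg : Measurable (fun x : E d => f (proj k (S d) x)) :=
    f.continuous.measurable.comp (measurable_proj k (S d))
  have hmean : ∫ y, f (proj k (S d) y) ∂(stdGaussian (E d)) = c := by
    rw [← integral_map (measurable_proj k (S d)).aemeasurable
      f.continuous.measurable.aestronglyMeasurable, map_proj_stdGaussian hSd]
  have hmeas : MeasurableSet {x : ℕ → E d | ε ≤ |(1 / (M d : ℝ)) *
      ∑ m ∈ Finset.range (M d), f (proj k (S d) (x m)) - c|} := by
    refine measurableSet_le measurable_const (Measurable.abs ?_)
    exact ((Finset.measurable_fun_sum _ fun i _ =>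
      hg.comp (measurable_pi_apply i)).const_mul _).sub_const _
  rw [hmean, pCN, Measure.map_apply (measurable_chain ρ _) hmeas]
  refine le_trans (measure_mono_ae ?_)
    (measure_autoreg_average_ge_le hρ0 hρ1.le hSd f₀ hMd hε)
  filter_upwards [chain_eq_autoreg_ae d hρ0 hρ1.le] with p hp hpm
  change ε ≤ |_| at hpm
  change ε ≤ |_|
  simp only [hp] at hpm
  have hMd' : (M d : ℝ) ≠ 0 := Nat.cast_ne_zero.2 hMd.ne'
  have heq : (1 / (M d : ℝ)) * ∑ i ∈ Finset.range (M d), f₀ (proj k (S d) (autoreg ρ p.1 p.2 i)) =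
      (1 / (M d : ℝ)) * ∑ i ∈ Finset.range (M d), f (proj k (S d) (autoreg ρ p.1 p.2 i)) - c := by
    have : ∀ x, f₀ x = f x - c := fun x => rfl
    simp_rw [this, Finset.sum_sub_distrib, Finset.sum_const, Finset.card_range, nsmul_eq_mul]
    field_simp
  rw [heq]
  exact hpm

end PCN

theorem theorem1 (ρ : ℝ) (hρ0 : 0 < ρ) (hρ1 : ρ < 1)
    (Q : MeasureTheory.Measure ℝ) [MeasureTheory.IsProbabilityMeasure Q]
    (hQ : Q (Set.Iic 0) = 0) :
    (PCN.HasPolynomialRate (fun d => PCN.pCN ρ (PCN.scaleMixture Q d)) (PCN.scaleMixture Q) ↔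
      Q = MeasureTheory.Measure.dirac 1) ∧
    (Q = MeasureTheory.Measure.dirac 1 →
      PCN.Consistent (fun d => PCN.pCN ρ (PCN.scaleMixture Q d)) (PCN.scaleMixture Q) ∧
      PCN.WeaklyConsistent (fun d => PCN.pCN ρ (PCN.scaleMixture Q d)) (PCN.scaleMixture Q)
        (fun _ => 1)) := by
  have hcons : Q = MeasureTheory.Measure.dirac 1 →
      PCN.Consistent (fun d => PCN.pCN ρ (PCN.scaleMixture Q d)) (PCN.scaleMixture Q) := by
    rintro rfl
    have h := PCN.consistent_stdGaussian hρ0.le hρ1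
    simp_rw [← PCN.scaleMixture_dirac_one] at h
    exact h
  have hweak : Q = MeasureTheory.Measure.dirac 1 →
      PCN.WeaklyConsistent (fun d => PCN.pCN ρ (PCN.scaleMixture Q d)) (PCN.scaleMixture Q)
        (fun _ => 1) := fun hQ1 =>
    ⟨Filter.Eventually.of_forall fun _ => one_pos, fun M hM _ => hcons hQ1 M hM⟩
  refine ⟨⟨PCN.eq_dirac_of_hasPolynomialRate hρ0 hρ1 hQ, fun hQ1 => ?_⟩,
    fun hQ1 => ⟨hcons hQ1, hweak hQ1⟩⟩
  refine ⟨fun _ => 1, hweak hQ1, 1, ?_⟩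
  simpa using tendsto_one_div_atTop_nhds_zero_nat (𝕜 := ℝ)
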